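/- **Setting.** Let $d\in\{1,2,3\}$, let $\Omega\subset\mathbb R^d$ be open and bounded, or $d=1$ and $\Omega=[0,L]$ with $L>0$, and let $0<n_-<n_+<\infty$. Let $\mathcal A$ be the set of measurable $n:\mathbb R^d\to\mathbb R$ with $n_-\le n\le n_+$ a.e. on $\overline\Omega$ and $n=1$ a.e. off $\overline\Omega$. The outgoing Green's function is $$G(r,\omega)=-\frac{e^{i\omega r}}{2i\omega}\ (d=1),\qquad G(r,\omega)=-\frac{1}{4i}H^{(1)}_0(\omega r)\ (d=2),\qquad G(r,\omega)=\frac{e^{i\omega r}}{4\pi r}\ (d=3),$$ where for $d=2$ any determination of $H_0^{(1)}$ (that is, of $\log\omega$) that is holomorphic near the frequency considered may be used. Put $$(T_{\omega}^{n}u)(x)=\omega^2\int_\Omega G(|x-y|,\omega)\,(n(y)^2-1)\,u(y)\,dy .$$ A *scattering resonance pair* of $n$ is a pair $(\omega,u)$ with $\omega\in\mathbb C$ and $u\in L^1_{\rm loc}(\mathbb R^d)$, $u\neq0$, such that $u=T_\omega^n u$; $u$ is identified with its continuous representative, so that the equation holds at every point. $\mathrm{Res}_n$ is the set of such $\omega$.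 The pair is *nondegenerate* if $\omega$ is an algebraically simple eigenvalue of $z\mapsto \mathrm{Id}-T_z^n$: every solution $v\in L^1_{\rm loc}$ of $v=T_\omega^nv$ is a multiple of $u$, and no $w\in L^1_{\rm loc}$ satisfies $w-T_\omega^n w=\partial_z(T_z^nu)|_{z=\omega}$. **Proposition.** Let $n\in\mathcal A$ and let $(\omega,u)$ be a nondegenerate scattering resonance pair of $n$. Then there are $\varepsilon,\delta>0$ such that every $n'\in\mathcal A$ with $\|n'-n\|_{L^\infty(\Omega)}<\delta$ has exactly one resonance $\omega[n']$ with $|\omega[n']-\omega|<\varepsilon$ (and $\omega[n]=\omega$), and the following hold. 1. There is $\alpha\in\mathbb C\setminus\{0\}$ (depending on $u$) such that $\omega[\cdot]$ has at $n$ the first variation $$\frac{\delta\omega}{\delta n}(x)=-2\,\overline\alpha\,\overline\omega^{2}\,n(x)\,\overline{u(x)}^{2}\in L^1(\Omega),$$ that is, for $n+\delta n\in\mathcal A$, as $\|\delta n\|_{L^\infty(\Omega)}\to0$, $$\omega[n+\delta n]-\omega[n]-\int_\Omega\overline{\frac{\delta\omega}{\delta n}(x)}\;\delta n(x)\,dx=o\bigl(\|\delta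 n\|_{L^\infty(\Omega)}\bigr).$$ 2. If $d=1$ and $\Omega=[0,L]$, then $u$ is $C^1$, and part 1 holds with the $\alpha\ne0$ given by $$\alpha^{-1}=2\omega\int_0^L n^2u^2\,dx+i\,[u(0)^2+u(L)^2]=\frac1\omega\int_0^L\bigl(u_x^2+\omega^2n^2u^2\bigr)\,dx .$$ -/

import Mathlib

open MeasureTheory Filter Topology
open scoped Nat ENNReal ComplexConjugate

noncomputable section

namespace ScatteringResonance

/-! ### The outgoing free-space Green's functions -/

/-- The Bessel function `J₀`, by its (everywhere convergent) power series. -/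
def besselJ0 (z : ℂ) : ℂ :=
  ∑' k : ℕ, (-1 : ℂ) ^ k / ((k ! : ℂ)) ^ 2 * (z / 2) ^ (2 * k)

/-- The Bessel function `Y₀` at `z`, by its classical expansion
`Y₀(z) = (2/π) ((log (z/2) + γ) J₀(z) + ∑ₖ (-1)^(k+1) Hₖ (z/2)^(2k) / (k!)²)`, where `Hₖ` is the
`k`-th harmonic number and `γ` is Euler's constant. The argument `lz` is the value of `log z` that
is used: `Y₀` is multivalued, and its determinations are those of the logarithm. -/
def besselY0 (z lz : ℂ) : ℂ :=
  2 / (Real.pi : ℂ) *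
    ((lz - (Real.log 2 : ℂ) + (Real.eulerMascheroniConstant : ℂ)) * besselJ0 z +
      ∑' k : ℕ, (-1 : ℂ) ^ (k + 1) * ((harmonic k : ℚ) : ℂ) / ((k ! : ℂ)) ^ 2 *
        (z / 2) ^ (2 * k))

/-- The Hankel function `H₀⁽¹⁾ = J₀ + i Y₀`, where `lz` is the value of `log z` that is used. -/
def hankelH0 (z lz : ℂ) : ℂ := besselJ0 z + Complex.I * besselY0 z lz

/-- The outgoing Green's function for `d = 1`, at distance `r` and frequency `z`. -/
def green1 (r : ℝ) (z : ℂ) : ℂ := -(2 * Complex.I * z)⁻¹ * Complex.exp (Complex.I * z * r)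

/-- The outgoing Green's function for `d = 2`, `-(4i)⁻¹ H₀⁽¹⁾(z r)`; here `lg` is the determination
of the logarithm of the frequency, and `log (z r) = lg z + log r` for `r > 0`. -/
def green2 (lg : ℂ → ℂ) (r : ℝ) (z : ℂ) : ℂ :=
  -(4 * Complex.I)⁻¹ * hankelH0 (z * r) (lg z + (Real.log r : ℂ))

/-- The outgoing Green's function for `d = 3`. -/
def green3 (r : ℝ) (z : ℂ) : ℂ :=
  (4 * (Real.pi : ℂ) * (r : ℂ))⁻¹ * Complex.exp (Complex.I * z * r)

/-- The outgoing Green's function in dimension `d = 1, 2, 3` (the value `0` for other `d` is never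
used). The determination `lg` of the logarithm matters only for `d = 2`. -/
def outgoingGreen (lg : ℂ → ℂ) (d : ℕ) : ℝ → ℂ → ℂ :=
  match d with
  | 1 => green1
  | 2 => green2 lg
  | 3 => green3
  | _ => fun _ _ => 0

/-- `lg` is, near `ω`, a holomorphic determination of the logarithm. -/
def IsLogDeterminationAt (lg : ℂ → ℂ) (ω : ℂ) : Prop :=
  AnalyticAt ℂ lg ω ∧ ∀ᶠ z in 𝓝 ω, Complex.exp (lg z) = z

/-! ### Admissible indices, scattering resonances -/

section Defs

variable {E : Type*} [NormedAddCommGroup E] [MeasureSpace E]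

/-- The admissible class `𝒜(Ω, n₋, n₊)`: measurable indices with `n₋ ≤ n ≤ n₊` on the closure of
`Ω` and `n = 1` off the closure of `Ω` (up to null sets, `𝒜` being a subset of `L^∞`). -/
def Admissible (Ω : Set E) (nm np : ℝ) : Set (E → ℝ) :=
  {n | AEMeasurable n volume ∧ (∀ᵐ x, x ∈ closure Ω → nm ≤ n x ∧ n x ≤ np) ∧
    ∀ᵐ x, x ∉ closure Ω → n x = 1}

/-- `z² ∫_Ω G(|x - y|, z) (n(y)² - 1) u(y) dy`, the right-hand side of the scattering resonance
problem at frequency `z`. -/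
def scatteringOp (G : ℝ → ℂ → ℂ) (Ω : Set E) (n : E → ℝ) (z : ℂ) (u : E → ℂ) (x : E) : ℂ :=
  z ^ 2 * ∫ y in Ω, G ‖x - y‖ z * ((n y : ℂ) ^ 2 - 1) * u y

/-- `(ω, u)` is a scattering resonance pair: `u` is a nontrivial locally integrable solution of the
scattering resonance problem. (The equation, imposed at every point, selects the continuous
representative of the mode.) -/
def IsResonancePair (G : ℝ → ℂ → ℂ) (Ω : Set E) (n : E → ℝ) (ω : ℂ) (u : E → ℂ) : Prop :=
  LocallyIntegrable u volume ∧ u ≠ 0 ∧ ∀ x, u x = scatteringOp G Ω n ω u x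

/-- The set `Res_n` of scattering resonances. -/
def Res (G : ℝ → ℂ → ℂ) (Ω : Set E) (n : E → ℝ) : Set ℂ :=
  {ω | ∃ u, IsResonancePair G Ω n ω u}

/-- The resonance pair `(ω, u)` is nondegenerate, that is, `ω` is a simple eigenvalue (of algebraic
multiplicity one) of the holomorphic family `A(z) = Id - z² R_z`, where `z² R_z` is `scatteringOp`:
every mode at `ω` is a multiple of `u`, and `u` has no generalized (associated) mode, i.e. no `w`
with `A(ω) w + A'(ω) u = 0`. -/
def IsNondegenerate (G : ℝ → ℂ → ℂ) (Ω : Set E) (n : E → ℝ) (ω : ℂ) (u : E → ℂ) : Prop :=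
  (∀ v, IsResonancePair G Ω n ω v → ∃ c : ℂ, v = c • u) ∧
  ¬ ∃ w : E → ℂ, LocallyIntegrable w volume ∧
    ∀ x, w x - scatteringOp G Ω n ω w x = deriv (fun z => scatteringOp G Ω n z u x) ω

/-- The norm of `L^∞(Ω)`, with values in `[0, ∞]`. -/
def supNorm (Ω : Set E) (h : E → ℝ) : ℝ≥0∞ := eLpNorm h ∞ (volume.restrict Ω)

/-- `W` is, near the index `n`, the map `n' ↦ ω[n']` that continues the resonance `ω` of `n`:
`W n = ω`, and for admissible `n'` near `n` in `L^∞`, `W n'` is the one and only resonance of `n'`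
in a fixed disc about `ω`. This determines `W` near `n`. -/
def IsResonanceMapAt (G : ℝ → ℂ → ℂ) (Ω : Set E) (nm np : ℝ) (n : E → ℝ) (ω : ℂ)
    (W : (E → ℝ) → ℂ) : Prop :=
  W n = ω ∧ ∃ ε : ℝ, 0 < ε ∧ ∃ δ : ℝ, 0 < δ ∧
    ∀ n' ∈ Admissible Ω nm np, supNorm Ω (n' - n) < ENNReal.ofReal δ →
      W n' ∈ Metric.ball ω ε ∧ Res G Ω n' ∩ Metric.ball ω ε = {W n'}

/-- `J` is Fréchet differentiable at `n` along the admissible class, with first variation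
`δJ/δn = g ∈ L¹(Ω)`: for admissible `n' = n + δn`,
`J[n + δn] - J[n] - ∫_Ω conj(g) δn = o(‖δn‖_{L^∞(Ω)})`. -/
def HasFirstVariationAt (Ω : Set E) (nm np : ℝ) (J : (E → ℝ) → ℂ) (n : E → ℝ) (g : E → ℂ) :
    Prop :=
  IntegrableOn g Ω volume ∧
  ∀ ε : ℝ, 0 < ε → ∃ δ : ℝ, 0 < δ ∧
    ∀ n' ∈ Admissible Ω nm np, supNorm Ω (n' - n) < ENNReal.ofReal δ →
      ‖J n' - J n - ∫ x in Ω, conj (g x) * ((n' x - n x : ℝ) : ℂ)‖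
        ≤ ε * (supNorm Ω (n' - n)).toReal

/-- The function `-2 ᾱ ω̄² n ū²`. -/
def gradOmega (α ω : ℂ) (n : E → ℝ) (u : E → ℂ) (x : E) : ℂ :=
  -2 * conj α * conj ω ^ 2 * (n x : ℂ) * conj (u x) ^ 2

end Defs

end ScatteringResonance

end

/-! ### Simple eigenvalues of compact operator families -/

section Abstract

variable {X : Type*} [NormedAddCommGroup X] [NormedSpace ℂ X] [CompleteSpace X]

/-! Put `V = n² - 1`. Since `Ω` is bounded, only the kernel `z² G(|x|, z)` on a ball enters the
equation on `Ω`, and this truncated kernel is a holomorphic curve in `L¹`. The resonance problem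
thus becomes the fixed point equation `R(z) M(V) v = v` on `L¹(Ω)`, where `M(V)` is multiplication
by `V` and `R(z)` is convolution, a compact operator (`isCompactOperator_convL1`). A fixed point in
`L¹(Ω)` extends to a pointwise solution on the whole space by applying the integral operator once
more.

Let `f` be the frequency derivative of the operator applied to `u`. Nondegeneracy says that the
kernel of `1 - T` is spanned by `u` and that `f` is not in its range. By the Fredholm alternative
the bordered operator `1 - T + f ⊗ l`, with `l(u) = 1`, is invertible (`isUnit_bordered`). It stays
invertible nearby, and there resonances are the solutions of the scalar equation `l((1 - T + f ⊗
l)⁻¹ f) = 1`. The `z`-derivative of the left side at `ω` is `1`, so the implicit function theorem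
gives `z = W(V)`, with derivative `δV ↦ -χ(R(ω) M(δV) u)`, where `χ` annihilates the range of `1 -
T` and `χ(f) = 1` (`exists_simple_resonance_branch`).

The functional `χ` is explicit because the kernel is even: `ψ(v) = ∫ V u v` also annihilates the
range, so `ψ = F χ` with `F = ψ(f)`. Boundedness of `ψ` on `L¹` needs `u` bounded
(`exists_ae_bound_of_eq_conv`). Then `δω = -F⁻¹ ∫ δV u²`, and `δV = 2 n δn + (δn)²` gives the
formula with `α⁻¹ = ω² F` (`exists_resonanceMap`).

On an interval, `u` solves `u'' + ω² n² u = 0` with outgoing boundary conditions, and `f` solves the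
equation differentiated in `ω`. Green's identity for `u` and `f`, and integration of `(u u')'`,
evaluate `α⁻¹` (`normalization_eq_of_primitives`). -/

theorem isCompactOperator_smulRight {X Y : Type*} [NormedAddCommGroup X] [NormedSpace ℂ X]
    [NormedAddCommGroup Y] [NormedSpace ℂ Y] (l : X →L[ℂ] ℂ) (f : Y) :
    IsCompactOperator (l.smulRight f) := by
  have : l.smulRight f = (ContinuousLinearMap.toSpanSingleton ℂ f).comp l := by
    ext x; simp
  rw [this]
  exact IsCompactOperator.comp_clm (isCompactOperator_of_locallyCompactSpace_rng
    (ContinuousLinearMap.toSpanSingleton ℂ f)) l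

/-- Fredholm alternative, bordered form: adding a rank one operator makes `1 - T` invertible when
`1` is an algebraically simple eigenvalue in the sense that `f` is not in the range. -/
theorem isUnit_bordered {T : X →L[ℂ] X} (hT : IsCompactOperator T) {u f : X}
    (hker : ∀ v, T v = v → ∃ c : ℂ, v = c • u) (hf : ∀ w, w - T w ≠ f)
    (l : X →L[ℂ] ℂ) (hl : l u = 1) :
    IsUnit (1 - T + l.smulRight f) := by
  have hf0 : f ≠ 0 := fun h => hf 0 (by simp [h])
  -- The alternative is applied to the compact operator `T - f ⊗ l`. If it fixes `v`, then `v - T v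
  -- = -l(v) f`, so `l(v) = 0` because `f` is not in the range; hence `v = c u`, and `l(u) = 1`
  -- forces `c = 0`.
  set K : X →L[ℂ] X := T - l.smulRight f with hK
  have hKc : IsCompactOperator K := by
    exact hT.sub (isCompactOperator_smulRight l f)
  have h := IsCompactOperator.hasEigenvalue_or_mem_resolventSet hKc (one_ne_zero (α := ℂ))
  rcases h with h | h
  · obtain ⟨v, hv⟩ := h.exists_hasEigenvector
    exfalso
    have hv1 : K v = v := by simpa using hv.apply_eq_smul
    have hv2 : T v - l v • f = v := by simpa [hK] using hv1
    have hlv : l v = 0 := by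
      by_contra hne
      refine hf (-(l v)⁻¹ • v) ?_
      have h3 : v - T v = -(l v • f) := by rw [eq_neg_iff_add_eq_zero]; nth_rewrite 1 [← hv2]; abel
      rw [map_smul, ← smul_sub, h3, smul_neg, neg_smul, neg_neg, smul_smul, inv_mul_cancel₀ hne,
        one_smul]
    rw [hlv, zero_smul, sub_zero] at hv2
    obtain ⟨c, rfl⟩ := hker v hv2
    have : c = 0 := by simpa [hl] using hlv
    exact hv.2 (by simp [this])
  · rw [spectrum.mem_resolventSet_iff] at h
    convert h using 1
    simp [hK, sub_add]

/-- Perturbation theory of an algebraically simple eigenvalue of a family `1 - R z ∘ M p`. -/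
theorem exists_simple_resonance_branch {P : Type*} [NormedAddCommGroup P] [NormedSpace ℂ P]
    [CompleteSpace P] {R : ℂ → X →L[ℂ] X} {R' : X →L[ℂ] X} {ω : ℂ} (hR : HasStrictDerivAt R R' ω)
    (M : P →L[ℂ] X →L[ℂ] X) (p₀ : P) (hT : IsCompactOperator (R ω ∘L M p₀)) {u : X} (hu0 : u ≠ 0)
    (hu : R ω (M p₀ u) = u) (hker : ∀ v, R ω (M p₀ v) = v → ∃ c : ℂ, v = c • u)
    (hf : ∀ w, w - R ω (M p₀ w) ≠ R' (M p₀ u)) :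
    ∃ (W : P → ℂ) (χ : X →L[ℂ] ℂ), W p₀ = ω ∧
      (∀ ρ > 0, ∃ ε > 0, ε ≤ ρ ∧ ∃ δ > 0, ∀ p, ‖p - p₀‖ < δ → W p ∈ Metric.ball ω ε ∧
        ∀ z ∈ Metric.ball ω ε, (∃ v, v ≠ 0 ∧ R z (M p v) = v) ↔ z = W p) ∧
      (∀ v, χ (v - R ω (M p₀ v)) = 0) ∧ χ (R' (M p₀ u)) = 1 ∧
      (∀ ψ : X →L[ℂ] ℂ, (∀ v, ψ (v - R ω (M p₀ v)) = 0) → ∀ v, ψ v = ψ (R' (M p₀ u)) * χ v) ∧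
      HasFDerivAt W (-(χ ∘L (R ω) ∘L M.flip u)) p₀ := by
  set f := R' (M p₀ u) with hfdef
  obtain ⟨l₀, hl₀⟩ := SeparatingDual.exists_eq_one (R := ℂ) hu0
  have hA₀ : IsUnit (1 - R ω ∘L M p₀ + l₀.smulRight f) :=
    isUnit_bordered hT hker hf l₀ hl₀
  obtain ⟨A₀, hA₀eq⟩ := hA₀
  set B : X →L[ℂ] X := ↑A₀⁻¹ with hB
  have hBA : ∀ v, B (v - R ω (M p₀ v) + l₀ v • f) = v := by
    intro v
    have h1 : (B * (A₀ : X →L[ℂ] X)) v = v := by simp [hB]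
    rw [hA₀eq] at h1
    simpa using h1
  have hAB : ∀ v, B v - R ω (M p₀ (B v)) + l₀ (B v) • f = v := by
    intro v
    have h1 : ((A₀ : X →L[ℂ] X) * B) v = v := by simp [hB]
    rw [hA₀eq] at h1
    simpa using h1
  have hBf : B f = u := by
    have := hBA u
    rwa [hu, sub_self, zero_add, hl₀, one_smul] at this
  set χ : X →L[ℂ] ℂ := l₀ ∘L B with hχ
  have hχf : χ f = 1 := by simp [hχ, hBf, hl₀]
  have hχ0 : ∀ v, χ (v - R ω (M p₀ v)) = 0 := by
    intro v
    have h1 := congrArg l₀ (hBA v)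
    rw [map_add, map_smul, hBf, map_add, map_smul, hl₀, smul_eq_mul, mul_one] at h1
    simpa [hχ] using h1
  -- The identity `v = (1 - T) B v + l₀(B v) f` shows that a functional vanishing on the range of `1
  -- - T` is determined by its value at `f`.
  have hψ : ∀ ψ : X →L[ℂ] ℂ, (∀ v, ψ (v - R ω (M p₀ v)) = 0) → ∀ v, ψ v = ψ f * χ v := by
    intro ψ hψ v
    conv_lhs => rw [← hAB v]
    rw [map_add, hψ, zero_add, map_smul, smul_eq_mul, mul_comm]
    rfl
  -- the bordered family and the scalar characteristic function
  let A : P × ℂ → X →L[ℂ] X := fun q => 1 - R q.2 ∘L M q.1 + l₀.smulRight f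
  let F : P × ℂ → ℂ := fun q => l₀ (Ring.inverse (A q) f)
  have hAp : A (p₀, ω) = A₀ := hA₀eq.symm
  have hFp : F (p₀, ω) = 1 := by
    simp only [F, hAp, Ring.inverse_unit]
    exact (congrArg l₀ hBf).trans hl₀
  let A' : P × ℂ →L[ℂ] X →L[ℂ] X :=
    -((((ContinuousLinearMap.compL ℂ X X X) (R ω)) ∘L (M ∘L ContinuousLinearMap.fst ℂ P ℂ)) +
      (ContinuousLinearMap.snd ℂ P ℂ).smulRight (R' ∘L M p₀))
  have hA' : HasStrictFDerivAt A A' (p₀, ω) := by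
    have h1 : HasStrictFDerivAt (fun q : P × ℂ => R q.2)
        ((ContinuousLinearMap.snd ℂ P ℂ).smulRight R') (p₀, ω) := by
      have := HasStrictFDerivAt.comp (x := ((p₀, ω) : P × ℂ)) (g := R) (f := Prod.snd)
        hR.hasStrictFDerivAt hasStrictFDerivAt_snd
      convert! this using 1
    have h2 : HasStrictFDerivAt (fun q : P × ℂ => M q.1)
        (M ∘L ContinuousLinearMap.fst ℂ P ℂ) (p₀, ω) :=
      (M ∘L ContinuousLinearMap.fst ℂ P ℂ).hasStrictFDerivAt
    have h3 := ((h1.clm_comp h2).const_sub 1).add_const (l₀.smulRight f)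
    convert! h3 using 1
  -- The derivative of inversion is `-B A' B`, and its sign cancels the one in `A'`. As `B f = u`,
  -- the `z`-part is `χ(R' M u) = χ(f) = 1`, which is the nonvanishing needed for the implicit
  -- function theorem.
  let F' : P × ℂ →L[ℂ] ℂ :=
    (χ ∘L (R ω) ∘L M.flip u) ∘L ContinuousLinearMap.fst ℂ P ℂ + ContinuousLinearMap.snd ℂ P ℂ
  have hF' : HasStrictFDerivAt F F' (p₀, ω) := by
    have h1 : HasStrictFDerivAt (Ring.inverse : (X →L[ℂ] X) → X →L[ℂ] X)
        (-ContinuousLinearMap.mulLeftRight ℂ (X →L[ℂ] X) ↑A₀⁻¹ ↑A₀⁻¹) (A (p₀, ω)) := by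
      rw [hAp]; exact hasStrictFDerivAt_ringInverse A₀
    have h2 := h1.comp (p₀, ω) hA'
    have h3 := (l₀.hasStrictFDerivAt.comp (p₀, ω)
      (((ContinuousLinearMap.apply ℂ X f).hasStrictFDerivAt).comp (p₀, ω) h2))
    convert! h3 using 1
    ext q
    · simp only [F', A', hχ]
      simp [← hB, hBf]
    · have : l₀ (B (R' (M p₀ u))) = 1 := by rw [← hfdef, hBf, hl₀]
      simp only [F', A', hχ]
      simp [← hB, hBf, this]
  have hinv : (F' ∘L .inr ℂ P ℂ) = ContinuousLinearMap.id ℂ ℂ := by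
    ext; simp [F']
  have hI : (F' ∘L .inr ℂ P ℂ).IsInvertible := by
    rw [hinv]; exact ⟨ContinuousLinearEquiv.refl ℂ ℂ, rfl⟩
  set W := hF'.implicitFunctionOfProdDomain hI with hW
  have hWp : W p₀ = ω :=
    (hF'.eventually_apply_eq_iff_implicitFunctionOfProdDomain hI).self_of_nhds.mp rfl
  have hWd := (hF'.hasStrictFDerivAt_implicitFunctionOfProdDomain hI).hasFDerivAt
  have hWd' : HasFDerivAt W (-(χ ∘L (R ω) ∘L M.flip u)) p₀ := by
    convert! hWd using 1
    rw [hinv]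
    ext p
    simp [F', ContinuousLinearMap.inverse_id]
  refine ⟨W, χ, hWp, ?_, hχ0, hχf, hψ, hWd'⟩
  -- resonances are the solutions of `F = 1`
  have hunit : ∀ᶠ q in 𝓝 ((p₀, ω) : P × ℂ), IsUnit (A q) := by
    have : {a : X →L[ℂ] X | IsUnit a} ∈ 𝓝 (A (p₀, ω)) := by
      rw [hAp]; exact A₀.nhds
    exact hA'.continuousAt this
  -- A fixed point `v` satisfies `A(q) v = l₀(v) f`, so `v = l₀(v) A(q)⁻¹ f` with `l₀(v) ≠ 0`, and
  -- applying `l₀` gives `F(q) = 1`. Conversely, if `F(q) = 1` then `A(q)⁻¹ f` is itself a nonzero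
  -- fixed point.
  have hiff : ∀ᶠ q in 𝓝 ((p₀, ω) : P × ℂ),
      (∃ v, v ≠ 0 ∧ R q.2 (M q.1 v) = v) ↔ q.2 = W q.1 := by
    filter_upwards [hunit, hF'.eventually_apply_eq_iff_implicitFunctionOfProdDomain hI]
      with q hq1 hq2
    rw [eq_comm (a := q.2), ← hq2, hFp]
    obtain ⟨a, ha⟩ := hq1
    have hFq : F q = l₀ ((↑a⁻¹ : X →L[ℂ] X) f) := by
      simp only [F, ← ha, Ring.inverse_unit]
    have haq : ∀ v, (a : X →L[ℂ] X) v = v - R q.2 (M q.1 v) + l₀ v • f := by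
      intro v; rw [ha]; simp [A]
    have hia : ∀ v, (↑a⁻¹ : X →L[ℂ] X) ((a : X →L[ℂ] X) v) = v := by
      intro v
      have : ((↑a⁻¹ : X →L[ℂ] X) * (a : X →L[ℂ] X)) v = v := by simp
      exact this
    have hai : ∀ v, (a : X →L[ℂ] X) ((↑a⁻¹ : X →L[ℂ] X) v) = v := by
      intro v
      have : ((a : X →L[ℂ] X) * (↑a⁻¹ : X →L[ℂ] X)) v = v := by simp
      exact this
    constructor
    · rintro ⟨v, hv0, hv⟩
      have h1 : (↑a⁻¹ : X →L[ℂ] X) (l₀ v • f) = v := by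
        have := hia v
        rwa [haq, hv, sub_self, zero_add] at this
      rw [map_smul] at h1
      have hlv : l₀ v ≠ 0 := by
        intro h; rw [h, zero_smul] at h1; exact hv0 h1.symm
      have h2 := congrArg l₀ h1
      rw [map_smul, smul_eq_mul] at h2
      rw [hFq]
      exact mul_left_cancel₀ hlv (by rw [h2, mul_one])
    · intro h
      rw [hFq] at h
      refine ⟨(↑a⁻¹ : X →L[ℂ] X) f, ?_, ?_⟩
      · intro h0; rw [h0, map_zero] at h; exact zero_ne_one h
      · have := hai f
        rw [haq, h, one_smul] at this
        have h2 : (↑a⁻¹ : X →L[ℂ] X) f - R q.2 (M q.1 ((↑a⁻¹ : X →L[ℂ] X) f)) = 0 := by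
          simpa using this
        exact (sub_eq_zero.mp h2).symm
  rw [nhds_prod_eq, eventually_prod_iff] at hiff
  obtain ⟨pa, hpa, pb, hpb, hab⟩ := hiff
  intro ρ hρ
  obtain ⟨ε', hε', hεb⟩ := Metric.eventually_nhds_iff_ball.mp hpb
  set ε := min ε' ρ
  have hε : 0 < ε := lt_min hε' hρ
  have hWc : ∀ᶠ p in 𝓝 p₀, W p ∈ Metric.ball ω ε := by
    have := hWd'.continuousAt
    rw [ContinuousAt, hWp] at this
    exact this (Metric.ball_mem_nhds _ hε)
  obtain ⟨δ, hδ, hδb⟩ := Metric.eventually_nhds_iff_ball.mp (hpa.and hWc)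
  refine ⟨ε, hε, min_le_right _ _, δ, hδ, fun p hp => ?_⟩
  have hp' : p ∈ Metric.ball p₀ δ := by rwa [mem_ball_iff_norm]
  exact ⟨(hδb p hp').2, fun z hz => hab (hδb p hp').1
    (hεb z (Metric.ball_subset_ball (min_le_left _ _) hz))⟩

end Abstract

/-! ### Convolution operators on `L¹(Ω)` -/

section Convolution

variable {E : Type*} [NormedAddCommGroup E] [NormedSpace ℝ E] [FiniteDimensional ℝ E]
  [MeasureSpace E] [BorelSpace E] [(volume : Measure E).IsAddHaarMeasure] (Ω : Set E)

theorem integrable_conv_integrand {Ω : Set E} {k u : E → ℂ} (hk : Integrable k)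
    (hu : IntegrableOn u Ω) :
    Integrable (fun p : E × E => k (p.1 - p.2) * u p.2) (volume.prod (volume.restrict Ω)) := by
  have := Integrable.convolution_integrand (ContinuousLinearMap.mul ℝ ℂ) hu hk
  simpa [mul_comm] using this

theorem integrable_conv {Ω : Set E} {k u : E → ℂ} (hk : Integrable k) (hu : IntegrableOn u Ω) :
    Integrable (fun x => ∫ y in Ω, k (x - y) * u y) :=
  (integrable_conv_integrand hk hu).integral_prod_left

theorem ae_integrable_conv {Ω : Set E} {k u : E → ℂ} (hk : Integrable k) (hu : IntegrableOn u Ω) :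
    ∀ᵐ x, IntegrableOn (fun y => k (x - y) * u y) Ω :=
  (integrable_conv_integrand hk hu).prod_right_ae

/-- Young's inequality for `L¹`, by Tonelli and translation invariance; it makes convolution a
bounded bilinear map. -/
theorem integral_norm_conv_le {Ω : Set E} {k u : E → ℂ} (hk : Integrable k)
    (hu : IntegrableOn u Ω) :
    ∫ x in Ω, ‖∫ y in Ω, k (x - y) * u y‖ ≤ (∫ x, ‖k x‖) * ∫ y in Ω, ‖u y‖ := by
  have hI := (integrable_conv_integrand hk hu).norm
  calc ∫ x in Ω, ‖∫ y in Ω, k (x - y) * u y‖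
      ≤ ∫ x, ‖∫ y in Ω, k (x - y) * u y‖ :=
        setIntegral_le_integral (integrable_conv hk hu).norm
          (Eventually.of_forall fun x => norm_nonneg _)
    _ ≤ ∫ x, ∫ y in Ω, ‖k (x - y) * u y‖ :=
        integral_mono (integrable_conv hk hu).norm hI.integral_prod_left
          fun x => norm_integral_le_integral_norm _
    _ = ∫ y in Ω, ∫ x, ‖k (x - y) * u y‖ := integral_integral_swap hI
    _ = ∫ y in Ω, (∫ x, ‖k x‖) * ‖u y‖ := by
        congr 1; ext y
        simp_rw [norm_mul]
        rw [integral_mul_const, integral_sub_right_eq_self (fun x => ‖k x‖)]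
    _ = _ := integral_const_mul _ _

/-- The reflection `y ↦ x - y` preserves null sets, so the choice of representatives does not affect
the value at any `x`, not merely at almost every one. -/
theorem conv_congr {Ω : Set E} {k k' u u' : E → ℂ} (hk : k =ᵐ[volume] k')
    (hu : u =ᵐ[volume.restrict Ω] u') (x : E) :
    ∫ y in Ω, k (x - y) * u y = ∫ y in Ω, k' (x - y) * u' y := by
  refine integral_congr_ae ?_
  have h1 : (fun y => k (x - y)) =ᵐ[volume.restrict Ω] fun y => k' (x - y) :=
    ae_restrict_of_ae
      ((quasiMeasurePreserving_sub_left_of_right_invariant volume x).ae_eq_comp hk)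
  filter_upwards [h1, hu] with y h1 h2
  simp only [h1, h2]

theorem Lp_integrable {α : Type*} [MeasurableSpace α] {μ : Measure α} (u : Lp ℂ 1 μ) :
    Integrable u μ := L1.integrable_coeFn u

/-- Convolution with an integrable kernel, as an operator on `L¹(Ω)`. -/
noncomputable def convL1 :
    Lp ℂ 1 (volume : Measure E) →L[ℂ] Lp ℂ 1 (volume.restrict Ω) →L[ℂ] Lp ℂ 1 (volume.restrict Ω) :=
  LinearMap.mkContinuous₂
    (LinearMap.mk₂ ℂ
      (fun k u => ((integrable_conv (Lp_integrable k) (Lp_integrable u)).restrict (s := Ω)).toL1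
        (fun x => ∫ y in Ω, k (x - y) * u y))
      (fun k k' u => by
        rw [← Integrable.toL1_add, Integrable.toL1_eq_toL1_iff]
        filter_upwards [ae_restrict_of_ae (ae_integrable_conv (Lp_integrable k) (Lp_integrable u)),
          ae_restrict_of_ae (ae_integrable_conv (Lp_integrable k') (Lp_integrable u))] with x h1 h2
        rw [Pi.add_apply, ← integral_add h1 h2,
          conv_congr (Lp.coeFn_add k k') (ae_eq_refl (u : E → ℂ)) x]
        simp [add_mul])
      (fun c k u => by
        rw [← Integrable.toL1_smul, Integrable.toL1_eq_toL1_iff]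
        refine Eventually.of_forall fun x => ?_
        simp only [smul_eq_mul, ← integral_const_mul]
        rw [conv_congr (Lp.coeFn_smul c k) (ae_eq_refl (u : E → ℂ)) x]
        simp [mul_assoc])
      (fun k u u' => by
        rw [← Integrable.toL1_add, Integrable.toL1_eq_toL1_iff]
        filter_upwards [ae_restrict_of_ae (ae_integrable_conv (Lp_integrable k) (Lp_integrable u)),
          ae_restrict_of_ae (ae_integrable_conv (Lp_integrable k) (Lp_integrable u'))] with x h1 h2
        rw [Pi.add_apply, ← integral_add h1 h2,
          conv_congr (ae_eq_refl (k : E → ℂ)) (Lp.coeFn_add u u') x]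
        simp [mul_add])
      (fun c k u => by
        rw [← Integrable.toL1_smul, Integrable.toL1_eq_toL1_iff]
        refine Eventually.of_forall fun x => ?_
        simp only [smul_eq_mul, ← integral_const_mul]
        rw [conv_congr (ae_eq_refl (k : E → ℂ)) (Lp.coeFn_smul c u) x]
        simp [mul_left_comm]))
    1 (fun k u => by
      rw [one_mul, LinearMap.mk₂_apply, L1.norm_of_fun_eq_integral_norm, L1.norm_eq_integral_norm,
        L1.norm_eq_integral_norm]
      exact integral_norm_conv_le (Lp_integrable k) (Lp_integrable u))

variable {Ω}

theorem convL1_coeFn (k : Lp ℂ 1 (volume : Measure E)) (u : Lp ℂ 1 (volume.restrict Ω)) :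
    convL1 Ω k u =ᵐ[volume.restrict Ω] fun x => ∫ y in Ω, k (x - y) * u y :=
  Integrable.coeFn_toL1
    ((integrable_conv (Lp_integrable k) (Lp_integrable u)).restrict (s := Ω))

theorem convL1_coeFn_of_ae_eq {k : Lp ℂ 1 (volume : Measure E)} {u : Lp ℂ 1 (volume.restrict Ω)}
    {k' u' : E → ℂ} (hk : k =ᵐ[volume] k') (hu : u =ᵐ[volume.restrict Ω] u') :
    convL1 Ω k u =ᵐ[volume.restrict Ω] fun x => ∫ y in Ω, k' (x - y) * u' y :=
  (convL1_coeFn k u).trans (Eventually.of_forall fun x => conv_congr hk hu x)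

/-- Fubini: convolution with an even kernel is symmetric for the bilinear pairing of `L¹` with
bounded functions. -/
theorem integral_conv_mul_comm {k a b : E → ℂ} (hk : Integrable k) (hev : ∀ x, k (-x) = k x)
    (ha : IntegrableOn a Ω) {C : ℝ}
    (hbm : AEStronglyMeasurable b (volume.restrict Ω)) (hb : ∀ᵐ x ∂volume.restrict Ω, ‖b x‖ ≤ C) :
    ∫ x in Ω, b x * ∫ y in Ω, k (x - y) * a y = ∫ y in Ω, (∫ x in Ω, k (y - x) * b x) * a y := by
  have h0 : Integrable (fun p : E × E => k (p.1 - p.2) * a p.2)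
      ((volume.restrict Ω).prod (volume.restrict Ω)) :=
    (integrable_conv_integrand hk ha).mono_measure
      (Measure.prod_mono Measure.restrict_le_self le_rfl)
  have hI : Integrable (fun p : E × E => b p.1 * (k (p.1 - p.2) * a p.2))
      ((volume.restrict Ω).prod (volume.restrict Ω)) := by
    exact h0.bdd_mul (c := C) hbm.comp_fst (Measure.quasiMeasurePreserving_fst.ae hb)
  calc ∫ x in Ω, b x * ∫ y in Ω, k (x - y) * a y
      = ∫ x in Ω, ∫ y in Ω, b x * (k (x - y) * a y) := by simp_rw [integral_const_mul]
    _ = ∫ y in Ω, ∫ x in Ω, b x * (k (x - y) * a y) := integral_integral_swap hI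
    _ = _ := by
        congr 1; ext y
        rw [← integral_mul_const]
        congr 1; ext x
        rw [← hev (x - y), neg_sub]; ring

/-- The functional `g ↦ ∫_Ω b g` on `L¹(Ω)`, for bounded `b`. -/
theorem exists_clm_integral_mul {α : Type*} [MeasurableSpace α] {μ : Measure α} {b : α → ℂ} {C : ℝ}
    (hbm : AEStronglyMeasurable b μ) (hb : ∀ᵐ x ∂μ, ‖b x‖ ≤ C) :
    ∃ l : Lp ℂ 1 μ →L[ℂ] ℂ, ∀ g, l g = ∫ x, b x * g x ∂μ := by
  have hb' : MemLp b ∞ μ := memLp_top_of_bound hbm C hb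
  refine ⟨(ContinuousLinearMap.mul ℂ ℂ).lpPairing μ ∞ 1 hb'.toLp, fun g => ?_⟩
  rw [ContinuousLinearMap.lpPairing_eq_integral]
  refine integral_congr_ae ?_
  filter_upwards [hb'.coeFn_toLp] with x hx
  simp [hx]

omit [(volume : Measure E).IsAddHaarMeasure] in
-- Total boundedness of `Ω`, in measurable form: send each point to the nearest centre of a finite
-- cover. Discretizing the integration variable this way produces finite rank operators.
theorem exists_simpleFunc_near {Ω : Set E} (hΩ : Bornology.IsBounded Ω) {η : ℝ} (hη : 0 < η) :
    ∃ π : SimpleFunc E E, ∀ y ∈ Ω, ‖π y - y‖ < η := by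
  have hc : IsCompact (closure Ω) := hΩ.isCompact_closure
  obtain ⟨t, ht⟩ := hc.elim_finite_subcover
    (fun k : ℕ => Metric.ball (TopologicalSpace.denseSeq E k) η) (fun k => Metric.isOpen_ball)
    (fun x _ => by
      obtain ⟨k, hy⟩ := (TopologicalSpace.denseRange_denseSeq E).exists_dist_lt x hη
      exact Set.mem_iUnion.mpr ⟨k, hy⟩)
  refine ⟨SimpleFunc.nearestPt (TopologicalSpace.denseSeq E) (t.sup id), fun y hy => ?_⟩
  obtain ⟨k, hk, hyk⟩ := Set.mem_iUnion₂.mp (ht (subset_closure hy))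
  have h1 := SimpleFunc.edist_nearestPt_le (TopologicalSpace.denseSeq E) y
    (Finset.le_sup (f := id) hk)
  rw [← dist_eq_norm, dist_comm]
  rw [edist_dist, edist_dist, ENNReal.ofReal_le_ofReal_iff dist_nonneg] at h1
  rw [dist_comm]
  refine h1.trans_lt ?_
  rw [dist_comm]; exact hyk

theorem Lp_coeFn_sum {α ι : Type*} [MeasurableSpace α] {μ : Measure α} (s : Finset ι)
    (f : ι → Lp ℂ 1 μ) : (∑ i ∈ s, f i : Lp ℂ 1 μ) =ᵐ[μ] fun x => ∑ i ∈ s, f i x := by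
  classical
  induction s using Finset.induction_on with
  | empty => simpa using! Lp.coeFn_zero ℂ 1 μ
  | insert i s hi ih =>
    rw [Finset.sum_insert hi]
    filter_upwards [Lp.coeFn_add (f i) (∑ i ∈ s, f i), ih] with x h1 h2
    rw [h1, Pi.add_apply, h2, Finset.sum_insert hi]

/-- Replacing `k (x - y)` by `k (x - π y)`, with `π` of finite range, gives a finite rank operator.
By uniform continuity of `k` the error is at most `ε' ‖u‖` at almost every point of `Ω`, hence at
most `ε' m ‖u‖` in `L¹(Ω)`, where `m` is the measure of `Ω`. -/
theorem isCompactOperator_convL1_of_continuous (hΩ : Bornology.IsBounded Ω)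
    (hΩm : MeasurableSet Ω) {k : E → ℂ}
    (hk : Continuous k) (hks : HasCompactSupport k) (hki : Integrable k) :
    IsCompactOperator (convL1 Ω (hki.toL1 k)) := by
  have : IsFiniteMeasure (volume.restrict Ω) := ⟨by simpa using hΩ.measure_lt_top⟩
  refine isClosed_setOfPred_isCompactOperator.closure_subset ?_
  rw [Metric.mem_closure_iff]
  intro ε hε
  set m := (volume Ω).toReal
  have hm : 0 ≤ m := ENNReal.toReal_nonneg
  set ε' := ε / (2 * (m + 1)) with hε'
  have hε'0 : 0 < ε' := by positivity
  obtain ⟨η, hη, hkη⟩ := Metric.uniformContinuous_iff.mp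
    (hks.uniformContinuous_of_continuous hk) ε' hε'0
  obtain ⟨π, hπ⟩ := exists_simpleFunc_near hΩ hη
  have hl : ∀ p : E, ∃ l : Lp ℂ 1 (volume.restrict Ω) →L[ℂ] ℂ, ∀ g, l g =
      ∫ x in Ω, (π ⁻¹' {p}).indicator (fun _ => (1 : ℂ)) x * g x := fun p =>
    exists_clm_integral_mul (C := 1)
      ((measurable_const.indicator (π.measurableSet_fiber p)).aestronglyMeasurable)
      (Eventually.of_forall fun x => by
        by_cases h : x ∈ π ⁻¹' {p} <;> simp [h])
  choose l hl using hl
  have hsub : ∀ p : E, Integrable (fun x => k (x - p)) (volume.restrict Ω) := fun p =>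
    (hki.comp_sub_right p).restrict
  refine ⟨∑ p ∈ π.range, (l p).smulRight ((hsub p).toL1 _), ?_, ?_⟩
  · exact Submodule.sum_mem (compactOperator (RingHom.id ℂ) _ _)
      fun p _ => isCompactOperator_smulRight _ _
  · have hbd : ‖convL1 Ω (hki.toL1 k) - ∑ p ∈ π.range, (l p).smulRight ((hsub p).toL1 _)‖
        ≤ ε' * m := by
      refine ContinuousLinearMap.opNorm_le_bound _ (by positivity) fun u => ?_
      have hu := Lp_integrable u
      have hFu : ((∑ p ∈ π.range, (l p).smulRight ((hsub p).toL1 _)) u : Lp ℂ 1 _)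
          =ᵐ[volume.restrict Ω] fun x => ∫ y in Ω, k (x - π y) * u y := by
        have h1 : ∀ᵐ x ∂volume.restrict Ω, ∀ p ∈ π.range,
            (((l p).smulRight ((hsub p).toL1 _)) u : Lp ℂ 1 (volume.restrict Ω)) x
              = (l p u) * k (x - p) := by
          refine (Filter.eventually_all_finset π.range).mpr fun p _ => ?_
          filter_upwards [(hsub p).coeFn_toL1, Lp.coeFn_smul (l p u) ((hsub p).toL1 _)]
            with x h1 h2
          rw [ContinuousLinearMap.smulRight_apply, h2, Pi.smul_apply, h1, smul_eq_mul]
        rw [sum_apply]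
        filter_upwards [Lp_coeFn_sum π.range
          (fun p => ((l p).smulRight ((hsub p).toL1 _)) u), h1] with x hx h1
        rw [hx, Finset.sum_congr rfl h1]
        simp_rw [hl, ← integral_mul_const]
        have hint : ∀ p : E, IntegrableOn (fun y =>
            (π ⁻¹' {p}).indicator (fun _ => (1 : ℂ)) y * u y * k (x - p)) Ω := fun p => by
          refine Integrable.mul_const ?_ _
          refine hu.bdd_mul (c := 1)
            ((measurable_const.indicator (π.measurableSet_fiber p)).aestronglyMeasurable) ?_
          exact Eventually.of_forall fun x => by
            by_cases h : x ∈ π ⁻¹' {p} <;> simp [h]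
        rw [← integral_finsetSum _ fun p _ => hint p]
        congr 1; ext y
        rw [Finset.sum_eq_single (π y)]
        · simp [mul_comm]
        · intro p _ hp
          have : y ∉ π ⁻¹' {p} := fun h => hp h.symm
          simp [this]
        · exact fun h => absurd (SimpleFunc.mem_range_self π y) h
      have hπi : ∀ x, ∀ y ∈ Ω, ‖k (x - y) - k (x - π y)‖ ≤ ε' := fun x y hy => by
        rw [← dist_eq_norm]
        refine (hkη ?_).le
        rw [dist_eq_norm, sub_sub_sub_cancel_left]
        exact hπ y hy
      obtain ⟨D, hD⟩ := hk.bounded_above_of_compact_support hks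
      have hpt : ∀ᵐ x ∂volume.restrict Ω,
          ‖(convL1 Ω (hki.toL1 k) - ∑ p ∈ π.range, (l p).smulRight ((hsub p).toL1 _) :
            Lp ℂ 1 (volume.restrict Ω) →L[ℂ] Lp ℂ 1 (volume.restrict Ω)) u x‖ ≤ ε' * ‖u‖ := by
        filter_upwards [hFu, convL1_coeFn_of_ae_eq hki.coeFn_toL1 (ae_eq_refl (u : E → ℂ)),
          Lp.coeFn_sub (convL1 Ω (hki.toL1 k) u)
            ((∑ p ∈ π.range, (l p).smulRight ((hsub p).toL1 _)) u)] with x h1 h2 h3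
        have hi1 : IntegrableOn (fun y => k (x - y) * u y) Ω :=
          hu.bdd_mul (c := D) (by fun_prop) (Eventually.of_forall fun y => hD _)
        have hi2 : IntegrableOn (fun y => k (x - π y) * u y) Ω :=
          hu.bdd_mul (c := D)
            (hk.comp_aestronglyMeasurable
              (aestronglyMeasurable_const.sub π.measurable.aestronglyMeasurable))
            (Eventually.of_forall fun y => hD _)
        rw [sub_apply, h3, Pi.sub_apply, h1, h2, ← integral_sub hi1 hi2,
          L1.norm_eq_integral_norm, ← integral_const_mul]
        refine norm_integral_le_of_norm_le (hu.norm.const_mul _) ?_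
        filter_upwards [ae_restrict_mem hΩm] with y hy
        rw [← sub_mul, norm_mul]
        exact mul_le_mul_of_nonneg_right (hπi x y hy) (norm_nonneg _)
      rw [L1.norm_eq_integral_norm]
      have hle := integral_mono_of_nonneg (Eventually.of_forall fun x => norm_nonneg _)
        (integrable_const (μ := volume.restrict Ω) (ε' * ‖u‖)) hpt
      refine hle.trans (le_of_eq ?_)
      rw [integral_const, smul_eq_mul, measureReal_restrict_apply_univ, Measure.real]
      ring
    rw [dist_eq_norm]
    refine hbd.trans_lt ?_
    rw [hε', div_mul_eq_mul_div, div_lt_iff₀ (by positivity)]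
    nlinarith

/-- Compactly supported continuous kernels are dense in `L¹`, the operator depends continuously on
its kernel, and compact operators form a closed set. -/
theorem isCompactOperator_convL1 (hΩ : Bornology.IsBounded Ω) (hΩm : MeasurableSet Ω)
    (k : Lp ℂ 1 (volume : Measure E)) : IsCompactOperator (convL1 Ω k) := by
  have hcl : IsClosed {k : Lp ℂ 1 (volume : Measure E) | IsCompactOperator (convL1 Ω k)} :=
    isClosed_setOfPred_isCompactOperator.preimage (convL1 Ω).continuous
  refine hcl.closure_subset ?_
  rw [Metric.mem_closure_iff]
  intro ε hε
  obtain ⟨g, hg1, hg2, hg3, hg4⟩ :=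
    (Lp_integrable k).exists_hasCompactSupport_integral_sub_le (half_pos hε)
  refine ⟨hg4.toL1 g, isCompactOperator_convL1_of_continuous hΩ hΩm hg3 hg1 hg4, ?_⟩
  rw [dist_eq_norm, L1.norm_eq_integral_norm]
  have : ∫ x, ‖(k - hg4.toL1 g : Lp ℂ 1 volume) x‖ = ∫ x, ‖k x - g x‖ := by
    refine integral_congr_ae ?_
    filter_upwards [Lp.coeFn_sub k (hg4.toL1 g), hg4.coeFn_toL1] with x h1 h2
    rw [h1, Pi.sub_apply, h2]
  rw [this]
  linarith

end Convolution

/-! ### Holomorphic families of integrable functions -/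

section Holomorphic

/-- Cauchy's estimate on a circle of radius `ρ / 4`, which stays in the large disc when its centre
is in the half disc. -/
theorem norm_deriv_le_of_norm_le_ball {f : ℂ → ℂ} {ω : ℂ} {ρ B : ℝ} (hρ : 0 < ρ)
    (hf : DifferentiableOn ℂ f (Metric.ball ω ρ)) (hB : ∀ z ∈ Metric.ball ω ρ, ‖f z‖ ≤ B)
    {z : ℂ} (hz : z ∈ Metric.ball ω (ρ / 2)) : ‖deriv f z‖ ≤ B / (ρ / 4) := by
  have hsub : Metric.closedBall z (ρ / 4) ⊆ Metric.ball ω ρ := fun w hw => by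
    rw [Metric.mem_ball] at *
    have := dist_triangle w z ω
    rw [Metric.mem_closedBall] at hw
    linarith
  refine Complex.norm_deriv_le_of_forall_mem_sphere_norm_le (by positivity) ?_
    fun w hw => hB w (hsub (Metric.sphere_subset_closedBall hw))
  exact (hf.mono hsub).diffContOnCl_ball subset_rfl

/-- Cauchy's estimate with radii `ρ / 4` and then `ρ / 8` bounds the second derivative by `32 B /
ρ²`, and the mean value inequality is applied twice. The bound is linear in `B`, so it can be
integrated over a parameter to give strict differentiability in `L¹`. -/
theorem norm_sub_sub_deriv_mul_le {f : ℂ → ℂ} {ω : ℂ} {ρ B η : ℝ} (hρ : 0 < ρ)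
    (hf : DifferentiableOn ℂ f (Metric.ball ω ρ)) (hB : ∀ z ∈ Metric.ball ω ρ, ‖f z‖ ≤ B)
    (hη : η ≤ ρ / 4) {z w : ℂ} (hz : z ∈ Metric.ball ω η) (hw : w ∈ Metric.ball ω η) :
    ‖f z - f w - (z - w) * deriv f ω‖ ≤ 32 * η / ρ ^ 2 * B * ‖z - w‖ := by
  have hη0 : 0 < η := dist_nonneg.trans_lt hz
  have hball : Metric.ball ω η ⊆ Metric.ball ω (ρ / 4) := Metric.ball_subset_ball hη
  have h42 : Metric.ball ω (ρ / 4) ⊆ Metric.ball ω (ρ / 2) :=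
    Metric.ball_subset_ball (by linarith)
  have h21 : Metric.ball ω (ρ / 2) ⊆ Metric.ball ω ρ := Metric.ball_subset_ball (by linarith)
  have hd : DifferentiableOn ℂ (deriv f) (Metric.ball ω ρ) := hf.deriv Metric.isOpen_ball
  have h1 : ∀ z ∈ Metric.ball ω (ρ / 2), ‖deriv f z‖ ≤ B / (ρ / 4) := fun z hz =>
    norm_deriv_le_of_norm_le_ball hρ hf hB hz
  have h2 : ∀ z ∈ Metric.ball ω (ρ / 4), ‖deriv (deriv f) z‖ ≤ 32 / ρ ^ 2 * B := fun z hz => by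
    have := norm_deriv_le_of_norm_le_ball (half_pos hρ) (hd.mono h21) h1 (z := z)
      (by rwa [div_div, show (2 : ℝ) * 2 = 4 by norm_num])
    refine this.trans (le_of_eq ?_)
    field_simp; ring
  have h3 : ∀ z ∈ Metric.ball ω η, ‖deriv f z - deriv f ω‖ ≤ 32 / ρ ^ 2 * B * η := fun z hz => by
    have hB0 : 0 ≤ 32 / ρ ^ 2 * B := (norm_nonneg _).trans (h2 ω (Metric.mem_ball_self (by linarith)))
    refine ((convex_ball ω (ρ / 4)).norm_image_sub_le_of_norm_deriv_le (𝕜 := ℂ)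
      (fun x hx => (hd x (h21 (h42 hx))).differentiableAt
        (Metric.isOpen_ball.mem_nhds (h21 (h42 hx)))) h2
      (Metric.mem_ball_self (by linarith)) (hball hz)).trans ?_
    rw [Metric.mem_ball, dist_eq_norm] at hz
    gcongr
  have h4 : ∀ z ∈ Metric.ball ω η, HasDerivAt (fun z => f z - z * deriv f ω)
      (deriv f z - deriv f ω) z := fun z hz => by
    have := ((hf z (h21 (h42 (hball hz)))).differentiableAt
      (Metric.isOpen_ball.mem_nhds (h21 (h42 (hball hz))))).hasDerivAt.sub
      ((hasDerivAt_id z).mul_const (deriv f ω))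
    convert! this using 1
    simp
  have h5 := (convex_ball ω η).norm_image_sub_le_of_norm_hasDerivWithin_le
    (fun x hx => (h4 x hx).hasDerivWithinAt) h3 hw hz
  convert! h5 using 1
  · congr 1; ring
  · ring

/-- A pointwise holomorphic, dominated family of functions is a holomorphic family in `L¹`. -/
theorem exists_hasStrictDerivAt_L1 {α : Type*} [MeasurableSpace α] {μ : Measure α}
    {κ : ℂ → α → ℂ} {ω : ℂ} {ρ : ℝ} (hρ : 0 < ρ) {b : α → ℝ} (hb : Integrable b μ)
    (hm : ∀ z ∈ Metric.ball ω ρ, AEStronglyMeasurable (κ z) μ)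
    (hd : ∀ᵐ x ∂μ, DifferentiableOn ℂ (fun z => κ z x) (Metric.ball ω ρ))
    (hκ : ∀ᵐ x ∂μ, ∀ z ∈ Metric.ball ω ρ, ‖κ z x‖ ≤ b x) :
    ∃ (R : ℂ → Lp ℂ 1 μ) (R' : Lp ℂ 1 μ), (∀ z ∈ Metric.ball ω ρ, R z =ᵐ[μ] κ z) ∧
      R' =ᵐ[μ] (fun x => deriv (fun z => κ z x) ω) ∧ HasStrictDerivAt R R' ω := by
  classical
  have hω : ω ∈ Metric.ball ω ρ := Metric.mem_ball_self hρ
  have hi : ∀ z ∈ Metric.ball ω ρ, Integrable (κ z) μ := fun z hz =>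
    hb.mono' (hm z hz) (hκ.mono fun x hx => hx z hz)
  have hdm : AEStronglyMeasurable (fun x => deriv (fun z => κ z x) ω) μ := by
    -- The derivative is measurable as a limit of difference quotients, taken along the real
    -- increments `(ρ / 2) / (n + 1)`, which keep the argument inside the disc.
    have hlim : Tendsto (fun n : ℕ => (((ρ / 2) / (n + 1) : ℝ) : ℂ)) atTop (𝓝[≠] 0) := by
      rw [tendsto_nhdsWithin_iff]
      constructor
      · rw [← Complex.ofReal_zero]
        refine (Complex.continuous_ofReal.tendsto 0).comp ?_
        have := tendsto_one_div_add_atTop_nhds_zero_nat.const_mul (ρ / 2)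
        simpa [div_eq_mul_inv] using this
      · refine Eventually.of_forall fun n => ?_
        have : (ρ / 2) / ((n : ℝ) + 1) ≠ 0 := by positivity
        simpa only [Set.mem_compl_iff, Set.mem_singleton_iff, Complex.ofReal_eq_zero] using this
    have hmem : ∀ n : ℕ, ω + (((ρ / 2) / (n + 1) : ℝ) : ℂ) ∈ Metric.ball ω ρ := fun n => by
      rw [mem_ball_iff_norm, add_sub_cancel_left, Complex.norm_real, Real.norm_of_nonneg
        (by positivity)]
      have : (ρ / 2) / ((n : ℝ) + 1) ≤ ρ / 2 := div_le_self (by positivity) (by linarith [n.cast_nonneg (α := ℝ)])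
      linarith
    refine aestronglyMeasurable_of_tendsto_ae atTop
      (f := fun n x => (((ρ / 2) / ((n : ℕ) + 1) : ℝ) : ℂ)⁻¹ •
        (κ (ω + (((ρ / 2) / (n + 1) : ℝ) : ℂ)) x - κ ω x))
      (fun n => (((hm _ (hmem n)).sub (hm ω hω)).const_smul
        ((((ρ / 2) / ((n : ℕ) + 1) : ℝ) : ℂ)⁻¹))) ?_
    filter_upwards [hd] with x hx
    have h1 := ((hx ω hω).differentiableAt (Metric.isOpen_ball.mem_nhds hω)).hasDerivAt
    exact (hasDerivAt_iff_tendsto_slope_zero.mp h1).comp hlim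
  have hdi : Integrable (fun x => deriv (fun z => κ z x) ω) μ := by
    refine (hb.div_const (ρ / 4)).mono' hdm ?_
    filter_upwards [hd, hκ] with x h1 h2
    exact norm_deriv_le_of_norm_le_ball hρ h1 h2 (Metric.mem_ball_self (by positivity))
  let R : ℂ → Lp ℂ 1 μ := fun z => if hz : z ∈ Metric.ball ω ρ then (hi z hz).toL1 _ else 0
  have hR : ∀ z ∈ Metric.ball ω ρ, R z =ᵐ[μ] κ z := fun z hz => by
    simp only [R, hz, dif_pos]; exact (hi z hz).coeFn_toL1
  refine ⟨R, hdi.toL1 _, hR, hdi.coeFn_toL1, ?_⟩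
  set I := ∫ x, b x ∂μ with hI
  have hI0 : 0 ≤ I := integral_nonneg_of_ae (hκ.mono fun x hx => (norm_nonneg _).trans (hx ω hω))
  have key : ∀ η, η ≤ ρ / 4 → ∀ z ∈ Metric.ball ω η, ∀ w ∈ Metric.ball ω η,
      ‖R z - R w - (z - w) • hdi.toL1 _‖ ≤ 32 * η / ρ ^ 2 * I * ‖z - w‖ := by
    intro η hη z hz w hw
    have hz' := Metric.ball_subset_ball (show η ≤ ρ by linarith) hz
    have hw' := Metric.ball_subset_ball (show η ≤ ρ by linarith) hw
    rw [L1.norm_eq_integral_norm, hI, mul_assoc, mul_comm (∫ x, b x ∂μ), ← mul_assoc,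
      ← integral_const_mul]
    refine integral_mono_ae (L1.integrable_coeFn _).norm (hb.const_mul _) ?_
    filter_upwards [hR z hz', hR w hw', hd, hκ, hdi.coeFn_toL1, Lp.coeFn_sub (R z) (R w),
      Lp.coeFn_sub (R z - R w) ((z - w) • hdi.toL1 _), Lp.coeFn_smul (z - w) (hdi.toL1 _)]
      with x h1 h2 h3 h4 h5 h6 h7 h8
    rw [h7, Pi.sub_apply, h6, Pi.sub_apply, h8, Pi.smul_apply, h1, h2, h5, smul_eq_mul]
    refine (norm_sub_sub_deriv_mul_le hρ h3 h4 hη hz hw).trans (le_of_eq ?_)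
    ring
  refine HasStrictFDerivAt.of_isLittleO ?_
  rw [Asymptotics.isLittleO_iff]
  intro c hc
  obtain ⟨η, hη0, hη1, hη2⟩ : ∃ η > 0, η ≤ ρ / 4 ∧ 32 * η / ρ ^ 2 * I ≤ c := by
    refine ⟨min (ρ / 4) (c * ρ ^ 2 / (32 * (I + 1))), by positivity, min_le_left _ _, ?_⟩
    have h1 := min_le_right (ρ / 4) (c * ρ ^ 2 / (32 * (I + 1)))
    set η := min (ρ / 4) (c * ρ ^ 2 / (32 * (I + 1)))
    have hη : 0 < η := by positivity
    rw [le_div_iff₀ (by positivity)] at h1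
    rw [div_mul_eq_mul_div, div_le_iff₀ (by positivity)]
    nlinarith
  filter_upwards [prod_mem_nhds (Metric.ball_mem_nhds ω hη0) (Metric.ball_mem_nhds ω hη0)]
    with p hp
  exact (key η hη1 p.1 hp.1 p.2 hp.2).trans (mul_le_mul_of_nonneg_right hη2 (norm_nonneg _))

end Holomorphic

/-! ### Boundedness of integrable solutions -/

section Bootstrap

variable {E : Type*} [NormedAddCommGroup E] [NormedSpace ℝ E] [FiniteDimensional ℝ E]
  [MeasureSpace E] [BorelSpace E] [(volume : Measure E).IsAddHaarMeasure] {Ω : Set E}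

/-- An integrable subsolution of a linear integral inequality with a kernel of small mass is
bounded. -/
theorem ae_le_of_le_lintegral {s w : E → ℝ≥0∞} (hs : Measurable s)
    (hw : AEMeasurable w (volume.restrict Ω)) (hwi : ∫⁻ y in Ω, w y ≠ ∞)
    (hs2 : ∫⁻ x, s x ≤ 1 / 2)
    {B : ℝ≥0∞} (h : ∀ᵐ x ∂volume.restrict Ω, w x ≤ (∫⁻ y in Ω, s (x - y) * w y) + B) :
    ∀ᵐ x ∂volume.restrict Ω, w x ≤ 2 * B := by
  -- The excess of `w` over `2 B`, by truncated subtraction. The constant `2 B` contributes at most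
  -- `B` through a kernel of mass at most `1 / 2`, so `v` satisfies the inequality without the term
  -- `B`. Then `∫ v ≤ ½ ∫ v` with `∫ v` finite, so `v` vanishes almost everywhere.
  set v : E → ℝ≥0∞ := fun x => w x - 2 * B with hv
  have hvm : AEMeasurable v (volume.restrict Ω) := hw.sub_const _
  have hsy : ∀ x, ∫⁻ y in Ω, s (x - y) ≤ 1 / 2 := fun x =>
    (setLIntegral_le_lintegral _ _).trans
      ((lintegral_sub_left_eq_self s x).le.trans hs2)
  have hv1 : ∀ᵐ x ∂volume.restrict Ω, v x ≤ ∫⁻ y in Ω, s (x - y) * v y := by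
    filter_upwards [h] with x hx
    rw [hv]
    simp only
    rw [tsub_le_iff_right]
    refine hx.trans ?_
    have h1 : ∫⁻ y in Ω, s (x - y) * w y ≤
        (∫⁻ y in Ω, s (x - y) * (w y - 2 * B)) + B := by
      calc ∫⁻ y in Ω, s (x - y) * w y
          ≤ ∫⁻ y in Ω, (s (x - y) * (w y - 2 * B) + s (x - y) * (2 * B)) := by
            refine lintegral_mono fun y => ?_
            rw [← mul_add]
            gcongr
            exact le_tsub_add
        _ = (∫⁻ y in Ω, s (x - y) * (w y - 2 * B)) + (∫⁻ y in Ω, s (x - y)) * (2 * B) := by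
            rw [lintegral_add_right, lintegral_mul_const]
            · fun_prop
            · fun_prop
        _ ≤ _ := by
            gcongr
            refine (mul_le_mul_left (hsy x) (2 * B)).trans (le_of_eq ?_)
            rw [← mul_assoc, one_div, ENNReal.inv_mul_cancel (by simp) (by simp), one_mul]
    calc _ ≤ ((∫⁻ y in Ω, s (x - y) * (w y - 2 * B)) + B) + B := by gcongr
      _ = _ := by rw [add_assoc, two_mul]
  have hvi : ∫⁻ y in Ω, v y ≠ ∞ :=
    ne_top_of_le_ne_top hwi (lintegral_mono fun y => tsub_le_self)
  have hv2 : ∫⁻ x in Ω, v x ≤ 1 / 2 * ∫⁻ y in Ω, v y := by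
    calc ∫⁻ x in Ω, v x ≤ ∫⁻ x in Ω, ∫⁻ y in Ω, s (x - y) * v y := lintegral_mono_ae hv1
      _ ≤ ∫⁻ x, ∫⁻ y in Ω, s (x - y) * v y := setLIntegral_le_lintegral _ _
      _ = ∫⁻ y in Ω, ∫⁻ x, s (x - y) * v y := by
          refine lintegral_lintegral_swap ?_
          exact AEMeasurable.mul (by fun_prop) hvm.comp_snd
      _ = ∫⁻ y in Ω, (∫⁻ x, s x) * v y := by
          congr 1; ext y
          rw [lintegral_mul_const _ (by fun_prop), lintegral_sub_right_eq_self s y]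
      _ = (∫⁻ x, s x) * ∫⁻ y in Ω, v y := lintegral_const_mul'' _ hvm
      _ ≤ _ := by gcongr
  have hv3 : ∫⁻ x in Ω, v x = 0 := by
    by_contra hne
    have : 1 / 2 * ∫⁻ y in Ω, v y < ∫⁻ y in Ω, v y := by
      rw [one_div, mul_comm, ← div_eq_mul_inv]; exact ENNReal.half_lt_self hne hvi
    exact absurd hv2 (not_le.mpr this)
  filter_upwards [(lintegral_eq_zero_iff' hvm).mp hv3] with x hx
  exact tsub_eq_zero_iff_le.mp hx

/-- Split `k = (k - g) + g` with `g` continuous of compact support and `k - g` of mass at most `1 /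
(2 c)`, where `c` bounds `V`. The `g` part maps `L¹` to bounded functions, and the remainder is
absorbed by `ae_le_of_le_lintegral`. -/
theorem exists_ae_bound_of_eq_conv {k V u : E → ℂ} {C : ℝ} (hk : Integrable k) (hkm : Measurable k)
    (hV : ∀ᵐ x ∂volume.restrict Ω, ‖V x‖ ≤ C) (hu : IntegrableOn u Ω)
    (h : ∀ᵐ x ∂volume.restrict Ω, u x = ∫ y in Ω, k (x - y) * (V y * u y)) :
    ∃ B : ℝ, ∀ᵐ x ∂volume.restrict Ω, ‖u x‖ ≤ B := by
  -- The maximum with `1` keeps `c` nonzero, so that dividing by it is harmless.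
  set c : ℝ≥0∞ := ENNReal.ofReal (max C 1) with hc
  have hc0 : c ≠ 0 := by simp [hc]
  have hct : c ≠ ∞ := ENNReal.ofReal_ne_top
  have hVc : ∀ᵐ x ∂volume.restrict Ω, ‖V x‖ₑ ≤ c := hV.mono fun x hx => by
    rw [← ofReal_norm]; exact ENNReal.ofReal_le_ofReal (hx.trans (le_max_left _ _))
  obtain ⟨g, hgs, hg1, hgc, hgi⟩ :=
    hk.exists_hasCompactSupport_lintegral_sub_le (ε := 2⁻¹ / c)
      (by simp [ENNReal.div_eq_zero_iff, hct])
  obtain ⟨D, hD⟩ := hgc.bounded_above_of_compact_support hgs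
  have hui : ∫⁻ y in Ω, ‖u y‖ₑ ≠ ∞ := hu.2.ne
  set B : ℝ≥0∞ := ENNReal.ofReal D * c * ∫⁻ y in Ω, ‖u y‖ₑ with hB
  have hBt : B ≠ ∞ := ENNReal.mul_ne_top (ENNReal.mul_ne_top ENNReal.ofReal_ne_top hct) hui
  have hmain := ae_le_of_le_lintegral (Ω := Ω) (s := fun x => ‖k x - g x‖ₑ * c)
    (w := fun y => ‖u y‖ₑ) (B := B) (by have := hgc.measurable; fun_prop)
    hu.aestronglyMeasurable.enorm hui
    (by
      rw [lintegral_mul_const' _ _ hct]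
      refine (mul_le_mul_left hg1 c).trans (le_of_eq ?_)
      rw [ENNReal.div_mul_cancel hc0 hct, one_div])
    (by
      filter_upwards [h] with x hx
      calc ‖u x‖ₑ ≤ ∫⁻ y in Ω, ‖k (x - y) * (V y * u y)‖ₑ := by
            conv_lhs => rw [hx]
            exact enorm_integral_le_lintegral_enorm _
        _ ≤ ∫⁻ y in Ω, (‖k (x - y) - g (x - y)‖ₑ * c * ‖u y‖ₑ + ENNReal.ofReal D * c * ‖u y‖ₑ) := by
            refine lintegral_mono_ae ?_
            filter_upwards [hVc] with y hy
            rw [enorm_mul, enorm_mul, ← add_mul, ← add_mul, ← mul_assoc]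
            gcongr
            calc ‖k (x - y)‖ₑ = ‖(k (x - y) - g (x - y)) + g (x - y)‖ₑ := by rw [sub_add_cancel]
              _ ≤ ‖k (x - y) - g (x - y)‖ₑ + ‖g (x - y)‖ₑ := enorm_add_le _ _
              _ ≤ _ := by
                gcongr
                rw [← ofReal_norm]; exact ENNReal.ofReal_le_ofReal (hD _)
        _ = _ := by
            rw [lintegral_add_right', lintegral_const_mul' _ _
              (ENNReal.mul_ne_top ENNReal.ofReal_ne_top hct)]
            exact hu.aestronglyMeasurable.enorm.const_mul _)
  refine ⟨(2 * B).toReal, hmain.mono fun x hx => ?_⟩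
  rw [← toReal_enorm]
  exact ENNReal.toReal_mono (ENNReal.mul_ne_top (by simp) hBt) hx

end Bootstrap

namespace ScatteringResonance

/-! ### Radial kernels depending holomorphically on the frequency -/

section Kernel

variable {E : Type*} [NormedAddCommGroup E] [NormedSpace ℝ E] [FiniteDimensional ℝ E]
  [MeasureSpace E] [BorelSpace E] [(volume : Measure E).IsAddHaarMeasure]

/-- The radial kernel `z² G(|x|, z)` is holomorphic in `z` on the disc of radius `ρ` about `ω`, with
a locally integrable bound. -/
structure IsHolomorphicKernel (E : Type*) [NormedAddCommGroup E] [MeasureSpace E]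
    (G : ℝ → ℂ → ℂ) (ω : ℂ) (ρ : ℝ) : Prop where
  pos : 0 < ρ
  measurable : ∀ z, Measurable fun r => G r z
  differentiableOn : ∀ r, 0 < r → DifferentiableOn ℂ (fun z => z ^ 2 * G r z) (Metric.ball ω ρ)
  bound : ∀ D : ℝ, ∃ b : ℝ → ℝ, IntegrableOn (fun x : E => b ‖x‖) (Metric.ball 0 D) ∧
    ∀ r, 0 < r → r < D → ∀ z ∈ Metric.ball ω ρ, ‖z ^ 2 * G r z‖ ≤ b r

/-- The convolution kernel of `scatteringOp`. -/
noncomputable def kernelFun (G : ℝ → ℂ → ℂ) (z : ℂ) (x : E) : ℂ := z ^ 2 * G ‖x‖ z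

/-- The derivative in the frequency of `kernelFun`. -/
noncomputable def kernelDeriv (G : ℝ → ℂ → ℂ) (ω : ℂ) (x : E) : ℂ :=
  deriv (fun z => z ^ 2 * G ‖x‖ z) ω

omit [NormedSpace ℝ E] [FiniteDimensional ℝ E] [BorelSpace E]
  [(volume : Measure E).IsAddHaarMeasure] in
theorem scatteringOp_eq_conv (G : ℝ → ℂ → ℂ) (Ω : Set E) (n : E → ℝ) (z : ℂ) (u : E → ℂ) (x : E) :
    scatteringOp G Ω n z u x =
      ∫ y in Ω, kernelFun G z (x - y) * (((n y : ℂ) ^ 2 - 1) * u y) := by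
  rw [scatteringOp, ← integral_const_mul]
  simp only [kernelFun, mul_assoc]

omit [NormedSpace ℝ E] [FiniteDimensional ℝ E] [BorelSpace E]
  [(volume : Measure E).IsAddHaarMeasure] in
theorem scatteringOp_congr (G : ℝ → ℂ → ℂ) {Ω : Set E} (n : E → ℝ) (z : ℂ) {u u' : E → ℂ}
    (h : u =ᵐ[volume.restrict Ω] u') (x : E) :
    scatteringOp G Ω n z u x = scatteringOp G Ω n z u' x := by
  rw [scatteringOp, scatteringOp]
  congr 1
  refine integral_congr_ae ?_
  filter_upwards [h] with y hy
  rw [hy]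

omit [FiniteDimensional ℝ E] [BorelSpace E] [NormedSpace ℝ E]
  [(volume : Measure E).IsAddHaarMeasure] in
-- The outgoing kernel need not be integrable on the whole space, but only differences `x - y` with
-- `y ∈ Ω` occur, and these stay in a ball when `x` does. This gives access to `L¹` convolution
-- theory.
theorem conv_indicator_ball_eq {Ω : Set E} (hΩm : MeasurableSet Ω) {r r' D : ℝ}
    (hr : Ω ⊆ Metric.ball 0 r) (hD : r' + r ≤ D) (k g : E → ℂ) {x : E} (hx : ‖x‖ < r') :
    ∫ y in Ω, (Metric.ball 0 D).indicator k (x - y) * g y = ∫ y in Ω, k (x - y) * g y := by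
  refine setIntegral_congr_fun hΩm fun y hy => ?_
  have : x - y ∈ Metric.ball (0 : E) D := by
    have h1 := hr hy
    rw [mem_ball_zero_iff] at h1 ⊢
    linarith [norm_sub_le x y]
  simp only [Set.indicator_of_mem this]

theorem locallyIntegrable_conv {Ω : Set E} (hΩm : MeasurableSet Ω) {r : ℝ}
    (hr : Ω ⊆ Metric.ball 0 r) {k g : E → ℂ} (hk : ∀ D, IntegrableOn k (Metric.ball 0 D))
    (hg : IntegrableOn g Ω) : LocallyIntegrable fun x => ∫ y in Ω, k (x - y) * g y := by
  intro x₀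
  refine ⟨Metric.ball 0 (‖x₀‖ + 1), Metric.isOpen_ball.mem_nhds (by simp), ?_⟩
  have h1 := (integrable_conv ((hk (‖x₀‖ + 1 + r)).integrable_indicator measurableSet_ball)
    hg).integrableOn (s := Metric.ball 0 (‖x₀‖ + 1))
  refine h1.congr_fun (fun x hx => ?_) measurableSet_ball
  exact conv_indicator_ball_eq hΩm hr le_rfl k g (by simpa using hx)

variable [Nontrivial E] {G : ℝ → ℂ → ℂ} {ω : ℂ} {ρ : ℝ}

omit [NormedSpace ℝ E] [FiniteDimensional ℝ E] [(volume : Measure E).IsAddHaarMeasure]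
  [Nontrivial E] in
theorem IsHolomorphicKernel.measurable_kernelFun (hK : IsHolomorphicKernel E G ω ρ) (z : ℂ) :
    Measurable (kernelFun (E := E) G z) :=
  ((hK.measurable z).comp measurable_norm).const_mul _

/-- The kernel, cut off to a ball, as a holomorphic curve in `L¹`. -/
theorem IsHolomorphicKernel.exists_cutoff (hK : IsHolomorphicKernel E G ω ρ) (D : ℝ) :
    ∃ (R : ℂ → Lp ℂ 1 (volume : Measure E)) (R' : Lp ℂ 1 (volume : Measure E)),
      (∀ z ∈ Metric.ball ω ρ,
        R z =ᵐ[volume] (Metric.ball 0 D).indicator (kernelFun G z)) ∧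
      R' =ᵐ[volume] (Metric.ball 0 D).indicator (kernelDeriv G ω) ∧ HasStrictDerivAt R R' ω := by
  obtain ⟨b, hbi, hb⟩ := hK.bound D
  have h0 : ∀ᵐ x : E, x ≠ 0 := by
    simp [ae_iff, measure_singleton]
  obtain ⟨R, R', h1, h2, h3⟩ := exists_hasStrictDerivAt_L1 (μ := (volume : Measure E))
    (κ := fun z => (Metric.ball 0 D).indicator (kernelFun G z)) hK.pos
    (hbi.integrable_indicator measurableSet_ball)
    (fun z _ => ((hK.measurable_kernelFun z).indicator measurableSet_ball).aestronglyMeasurable)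
    (h0.mono fun x hx => by
      by_cases hxD : x ∈ Metric.ball (0 : E) D
      · simp only [Set.indicator_of_mem hxD]
        exact hK.differentiableOn ‖x‖ (norm_pos_iff.mpr hx)
      · simp only [Set.indicator_of_notMem hxD]; fun_prop)
    (h0.mono fun x hx z hz => by
      by_cases hxD : x ∈ Metric.ball (0 : E) D
      · simp only [Set.indicator_of_mem hxD]
        exact hb ‖x‖ (norm_pos_iff.mpr hx) (by simpa using hxD) z hz
      · simp [Set.indicator_of_notMem hxD])
  refine ⟨R, R', h1, h2.trans (Eventually.of_forall fun x => ?_), h3⟩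
  by_cases hxD : x ∈ Metric.ball (0 : E) D
  · simp only [Set.indicator_of_mem hxD]; rfl
  · simp only [Set.indicator_of_notMem hxD, deriv_const]

theorem IsHolomorphicKernel.integrableOn_kernelFun (hK : IsHolomorphicKernel E G ω ρ) {z : ℂ}
    (hz : z ∈ Metric.ball ω ρ) (D : ℝ) : IntegrableOn (kernelFun (E := E) G z) (Metric.ball 0 D) := by
  obtain ⟨R, -, h1, -, -⟩ := hK.exists_cutoff (E := E) D
  rw [← integrable_indicator_iff measurableSet_ball]
  exact (Lp_integrable (R z)).congr (h1 z hz)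

theorem IsHolomorphicKernel.integrableOn_kernelDeriv (hK : IsHolomorphicKernel E G ω ρ)
    (D : ℝ) : IntegrableOn (kernelDeriv (E := E) G ω) (Metric.ball 0 D) := by
  obtain ⟨-, R', -, h2, -⟩ := hK.exists_cutoff (E := E) D
  rw [← integrable_indicator_iff measurableSet_ball]
  exact (Lp_integrable R').congr h2

/-- Differentiation in the frequency under the integral sign, at every point. -/
theorem IsHolomorphicKernel.hasDerivAt_conv (hK : IsHolomorphicKernel E G ω ρ) {Ω : Set E}
    (hΩm : MeasurableSet Ω) {r : ℝ} (hr : Ω ⊆ Metric.ball 0 r) {g : E → ℂ} {C : ℝ}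
    (hgm : AEStronglyMeasurable g (volume.restrict Ω)) (hg : ∀ᵐ x ∂volume.restrict Ω, ‖g x‖ ≤ C)
    (x : E) :
    HasDerivAt (fun z => ∫ y in Ω, kernelFun G z (x - y) * g y)
      (∫ y in Ω, kernelDeriv G ω (x - y) * g y) ω := by
  obtain ⟨R, R', h1, h2, h3⟩ := hK.exists_cutoff (E := E) (‖x‖ + 1 + r)
  have hC : ∀ᵐ y, ‖Ω.indicator g y‖ ≤ max C 0 := by
    rw [ae_restrict_iff' hΩm] at hg
    filter_upwards [hg] with y hy
    by_cases h : y ∈ Ω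
    · rw [Set.indicator_of_mem h]; exact (hy h).trans (le_max_left _ _)
    · rw [Set.indicator_of_notMem h, norm_zero]; exact le_max_right _ _
  have hqmp := quasiMeasurePreserving_sub_left_of_right_invariant (volume : Measure E) x
  -- Convolution with the bounded `g`, evaluated at the fixed point `x`, is a continuous functional
  -- of the `L¹` kernel, so the derivative of the kernel curve passes through it.
  obtain ⟨l, hl⟩ := exists_clm_integral_mul (μ := (volume : Measure E))
    (b := fun w => Ω.indicator g (x - w))
    (((aestronglyMeasurable_indicator_iff hΩm).mpr hgm).comp_quasiMeasurePreserving hqmp)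
    (hqmp.ae hC)
  have hl2 : ∀ (K : Lp ℂ 1 (volume : Measure E)) (k : E → ℂ),
      K =ᵐ[volume] (Metric.ball 0 (‖x‖ + 1 + r)).indicator k →
      l K = ∫ y in Ω, k (x - y) * g y := by
    intro K k hKk
    rw [hl, ← conv_indicator_ball_eq hΩm hr le_rfl k g (lt_add_one ‖x‖),
      ← integral_sub_left_eq_self _ volume x, ← integral_indicator hΩm]
    refine integral_congr_ae ?_
    filter_upwards [hqmp.ae_eq_comp hKk] with y hy
    simp only [Function.comp_apply] at hy
    rw [sub_sub_cancel, hy]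
    by_cases h : y ∈ Ω
    · simp only [Set.indicator_of_mem h, mul_comm]
    · simp only [Set.indicator_of_notMem h, zero_mul]
  have h4 := l.hasFDerivAt.comp_hasDerivAt ω h3.hasDerivAt
  rw [hl2 R' _ h2] at h4
  refine h4.congr_of_eventuallyEq ?_
  filter_upwards [Metric.isOpen_ball.mem_nhds (Metric.mem_ball_self hK.pos)] with z hz
  exact (hl2 (R z) _ (h1 z hz)).symm

end Kernel

end ScatteringResonance

namespace ScatteringResonance

/-! ### Continuation and first variation of a resonance for a general radial kernel. -/

section Generic

variable {E : Type*} [NormedAddCommGroup E] [NormedSpace ℝ E] [FiniteDimensional ℝ E]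
  [MeasureSpace E] [BorelSpace E] [(volume : Measure E).IsAddHaarMeasure] [Nontrivial E]
  {G : ℝ → ℂ → ℂ} {ω : ℂ} {ρ : ℝ} {Ω : Set E} {nm np : ℝ}

/-- Multiplication of `L¹(Ω)` by `L^∞(Ω)`. -/
noncomputable def mulL1 {α : Type*} [MeasurableSpace α] (μ : Measure α) :
    Lp ℂ ∞ μ →L[ℂ] Lp ℂ 1 μ →L[ℂ] Lp ℂ 1 μ :=
  (ContinuousLinearMap.mul ℂ ℂ).holderL μ ∞ 1 1

theorem mulL1_coeFn {α : Type*} [MeasurableSpace α] {μ : Measure α} (V : Lp ℂ ∞ μ)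
    (v : Lp ℂ 1 μ) : mulL1 μ V v =ᵐ[μ] fun x => V x * v x :=
  ContinuousLinearMap.coeFn_holder _ _ _

omit [NormedSpace ℝ E] [FiniteDimensional ℝ E] [BorelSpace E]
  [(volume : Measure E).IsAddHaarMeasure] [Nontrivial E] in
theorem Admissible.ae_bound {n : E → ℝ} (hn : n ∈ Admissible Ω nm np) (hnm : 0 < nm)
    (hΩm : MeasurableSet Ω) : ∀ᵐ x ∂volume.restrict Ω, ‖n x‖ ≤ np := by
  rw [ae_restrict_iff' hΩm]
  filter_upwards [hn.2.1] with x hx hxΩ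
  have := hx (subset_closure hxΩ)
  rw [Real.norm_of_nonneg (by linarith)]
  exact this.2

omit [NormedSpace ℝ E] [FiniteDimensional ℝ E] [BorelSpace E]
  [(volume : Measure E).IsAddHaarMeasure] [Nontrivial E] in
theorem Admissible.aestronglyMeasurable_contrast {n : E → ℝ} (hn : n ∈ Admissible Ω nm np) :
    AEStronglyMeasurable (fun x => (n x : ℂ) ^ 2 - 1) (volume.restrict Ω) := by
  have h := hn.1.restrict (s := Ω)
  exact (((Complex.measurable_ofReal.comp_aemeasurable h).pow_const 2).sub_const
    1).aestronglyMeasurable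

omit [NormedSpace ℝ E] [FiniteDimensional ℝ E] [BorelSpace E]
  [(volume : Measure E).IsAddHaarMeasure] [Nontrivial E] in
theorem Admissible.ae_bound_contrast {n : E → ℝ} (hn : n ∈ Admissible Ω nm np) (hnm : 0 < nm)
    (hΩm : MeasurableSet Ω) :
    ∀ᵐ x ∂volume.restrict Ω, ‖(n x : ℂ) ^ 2 - 1‖ ≤ np ^ 2 + 1 := by
  filter_upwards [Admissible.ae_bound hn hnm hΩm] with x hx
  refine (norm_sub_le _ _).trans ?_
  rw [norm_pow, Complex.norm_real, norm_one]
  gcongr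

/-- A resonance mode is bounded on `Ω`. -/
theorem IsResonancePair.exists_ae_bound (hK : IsHolomorphicKernel E G ω ρ) (hnm : 0 < nm)
    (hΩm : MeasurableSet Ω) (hΩ : Bornology.IsBounded Ω) {n : E → ℝ} {u : E → ℂ}
    (hn : n ∈ Admissible Ω nm np) (hu : IsResonancePair G Ω n ω u) :
    ∃ B : ℝ, ∀ᵐ x ∂volume.restrict Ω, ‖u x‖ ≤ B := by
  obtain ⟨r, hr⟩ := hΩ.subset_ball 0
  refine exists_ae_bound_of_eq_conv (k := (Metric.ball 0 (r + r)).indicator (kernelFun G ω))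
    ((hK.integrableOn_kernelFun (Metric.mem_ball_self hK.pos) _).integrable_indicator
      measurableSet_ball)
    ((hK.measurable_kernelFun ω).indicator measurableSet_ball)
    (Admissible.ae_bound_contrast hn hnm hΩm)
    ((hu.1.integrableOn_isCompact hΩ.isCompact_closure).mono_set subset_closure) ?_
  filter_upwards [ae_restrict_mem hΩm] with x hx
  rw [conv_indicator_ball_eq hΩm hr le_rfl _ _ (by simpa using hr hx), ← scatteringOp_eq_conv]
  exact hu.2.2 x

omit [NormedSpace ℝ E] [FiniteDimensional ℝ E] [BorelSpace E]
  [(volume : Measure E).IsAddHaarMeasure] [Nontrivial E] in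
theorem IsResonancePair.omega_ne_zero {n : E → ℝ} {u : E → ℂ}
    (hu : IsResonancePair G Ω n ω u) : ω ≠ 0 := by
  rintro rfl
  exact hu.2.1 (funext fun x => by rw [hu.2.2 x]; simp [scatteringOp])

/-- Existence, uniqueness and first variation of the resonance continuing a nondegenerate one, for
radial kernels depending holomorphically on the frequency. -/
theorem exists_resonanceMap (hK : IsHolomorphicKernel E G ω ρ) (hnm : 0 < nm) (hnp : nm < np)
    (hΩm : MeasurableSet Ω) (hΩ : Bornology.IsBounded Ω) {n : E → ℝ} {u : E → ℂ}
    (hn : n ∈ Admissible Ω nm np) (hu : IsResonancePair G Ω n ω u)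
    (hnd : IsNondegenerate G Ω n ω u) :
    ∃ W : (E → ℝ) → ℂ, IsResonanceMapAt G Ω nm np n ω W ∧ ∃ α : ℂ, α ≠ 0 ∧
      α⁻¹ = ω ^ 2 * ∫ x in Ω, (((n x : ℂ) ^ 2 - 1) * u x) *
        deriv (fun z => scatteringOp G Ω n z u x) ω ∧
      HasFirstVariationAt Ω nm np W n (gradOmega α ω n u) := by
  classical
  have : IsFiniteMeasure (volume.restrict Ω) := ⟨by simpa using hΩ.measure_lt_top⟩
  have hωρ := Metric.mem_ball_self (x := ω) hK.pos
  have hω0 := hu.omega_ne_zero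
  obtain ⟨r, hr⟩ := hΩ.subset_ball 0
  obtain ⟨R, R', hR, hR', hRd⟩ := hK.exists_cutoff (E := E) (r + r)
  obtain ⟨B, hB⟩ := hu.exists_ae_bound hK hnm hΩm hΩ hn
  set μ := volume.restrict Ω with hμ
  have hui : Integrable u μ :=
    (hu.1.integrableOn_isCompact hΩ.isCompact_closure).mono_set subset_closure
  -- contrasts as elements of `L^∞`
  have hVmem : ∀ n' ∈ Admissible Ω nm np, MemLp (fun x => (n' x : ℂ) ^ 2 - 1) ∞ μ :=
    fun n' hn' => memLp_top_of_bound (Admissible.aestronglyMeasurable_contrast hn') _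
      (Admissible.ae_bound_contrast hn' hnm hΩm)
  let V : (E → ℝ) → Lp ℂ ∞ μ := fun n' =>
    if h : n' ∈ Admissible Ω nm np then (hVmem n' h).toLp else 0
  have hV : ∀ n' ∈ Admissible Ω nm np, V n' =ᵐ[μ] fun x => (n' x : ℂ) ^ 2 - 1 := fun n' h => by
    simp only [V, h, dif_pos]; exact (hVmem n' h).coeFn_toLp
  -- the operator on `L¹` and the pointwise operator
  have hop : ∀ n' ∈ Admissible Ω nm np, ∀ z ∈ Metric.ball ω ρ, ∀ v : Lp ℂ 1 μ,
      convL1 Ω (R z) (mulL1 μ (V n') v) =ᵐ[μ] scatteringOp G Ω n' z v := by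
    intro n' hn' z hz v
    have h1 : mulL1 μ (V n') v =ᵐ[μ] fun x => ((n' x : ℂ) ^ 2 - 1) * v x :=
      (mulL1_coeFn _ _).trans ((hV n' hn').mul (ae_eq_refl _))
    filter_upwards [convL1_coeFn_of_ae_eq (hR z hz) h1, ae_restrict_mem hΩm] with x hx hxΩ
    rw [hx, conv_indicator_ball_eq hΩm hr le_rfl _ _ (by simpa using hr hxΩ),
      ← scatteringOp_eq_conv]
  have hloc : ∀ n' ∈ Admissible Ω nm np, ∀ z ∈ Metric.ball ω ρ, ∀ v : Lp ℂ 1 μ,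
      LocallyIntegrable (scatteringOp G Ω n' z v) := by
    intro n' hn' z hz v
    have h1 : IntegrableOn (fun x => ((n' x : ℂ) ^ 2 - 1) * v x) Ω :=
      (Lp_integrable v).bdd_mul (Admissible.aestronglyMeasurable_contrast hn') (Admissible.ae_bound_contrast hn' hnm hΩm)
    have := locallyIntegrable_conv hΩm hr (hK.integrableOn_kernelFun hz) h1
    simpa only [← scatteringOp_eq_conv] using this
  -- An `L¹(Ω)` fixed point is only a class on `Ω`. Applying the integral operator to any
  -- representative extends it to the whole space, and the equation then holds at every point.
  have hpair : ∀ n' ∈ Admissible Ω nm np, ∀ z ∈ Metric.ball ω ρ, ∀ v : Lp ℂ 1 μ, v ≠ 0 →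
      convL1 Ω (R z) (mulL1 μ (V n') v) = v →
      IsResonancePair G Ω n' z (scatteringOp G Ω n' z v) ∧
        scatteringOp G Ω n' z v =ᵐ[μ] v := by
    intro n' hn' z hz v hv0 hv
    have h1 : scatteringOp G Ω n' z v =ᵐ[μ] v := by
      have := hop n' hn' z hz v
      rw [hv] at this
      exact this.symm
    refine ⟨⟨hloc n' hn' z hz v, fun h0 => hv0 ?_, fun x => ?_⟩, h1⟩
    · rw [h0] at h1
      exact Lp.ext (h1.symm.trans (Lp.coeFn_zero ℂ 1 μ).symm)
    · exact scatteringOp_congr G n' z h1.symm x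
  have hres : ∀ n' ∈ Admissible Ω nm np, ∀ z ∈ Metric.ball ω ρ,
      (z ∈ Res G Ω n' ↔ ∃ v : Lp ℂ 1 μ, v ≠ 0 ∧ convL1 Ω (R z) (mulL1 μ (V n') v) = v) := by
    intro n' hn' z hz
    constructor
    · rintro ⟨w, hw⟩
      have hwi : Integrable w μ :=
        (hw.1.integrableOn_isCompact hΩ.isCompact_closure).mono_set subset_closure
      refine ⟨hwi.toL1 w, fun h0 => hw.2.1 ?_, ?_⟩
      · have h1 : w =ᵐ[μ] 0 := by
          have := hwi.coeFn_toL1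
          rw [h0] at this
          exact this.symm.trans (Lp.coeFn_zero ℂ 1 μ)
        funext x
        rw [hw.2.2 x, scatteringOp_congr G n' z h1 x]
        simp [scatteringOp]
      · refine Lp.ext ((hop n' hn' z hz _).trans ?_)
        filter_upwards [hwi.coeFn_toL1] with x hx
        rw [hx, scatteringOp_congr G n' z hwi.coeFn_toL1 x, ← hw.2.2 x]
    · rintro ⟨v, hv0, hv⟩
      exact ⟨_, (hpair n' hn' z hz v hv0 hv).1⟩
  -- the mode in `L¹`
  set u₀ : Lp ℂ 1 μ := hui.toL1 u with hu₀def
  have hu₀ : u₀ =ᵐ[μ] u := hui.coeFn_toL1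
  have hu₀0 : u₀ ≠ 0 := fun h0 => hu.2.1 (by
    have h1 : u =ᵐ[μ] 0 := by
      rw [h0] at hu₀
      exact hu₀.symm.trans (Lp.coeFn_zero ℂ 1 μ)
    funext x
    rw [hu.2.2 x, scatteringOp_congr G n ω h1 x]
    simp [scatteringOp])
  have hu₀fix : convL1 Ω (R ω) (mulL1 μ (V n) u₀) = u₀ := by
    refine Lp.ext ((hop n hn ω hωρ _).trans ?_)
    filter_upwards [hu₀] with x hx
    rw [hx, scatteringOp_congr G n ω hu₀ x, ← hu.2.2 x]
  -- differentiation in the frequency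
  set g : E → ℂ := fun x => ((n x : ℂ) ^ 2 - 1) * u x with hgdef
  have hgm : AEStronglyMeasurable g μ := (Admissible.aestronglyMeasurable_contrast hn).mul hui.1
  obtain ⟨Cg, hgb⟩ : ∃ C : ℝ, ∀ᵐ x ∂μ, ‖g x‖ ≤ C := by
    refine ⟨(np ^ 2 + 1) * B, ?_⟩
    filter_upwards [hB, (Admissible.ae_bound_contrast hn hnm hΩm)] with x h1 h2
    rw [hgdef, norm_mul]
    have := norm_nonneg (u x)
    gcongr
  have hgi : IntegrableOn g Ω :=
    hui.bdd_mul (Admissible.aestronglyMeasurable_contrast hn) (Admissible.ae_bound_contrast hn hnm hΩm)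
  have hder : ∀ x, deriv (fun z => scatteringOp G Ω n z u x) ω =
      ∫ y in Ω, kernelDeriv G ω (x - y) * g y := by
    intro x
    simp_rw [scatteringOp_eq_conv]
    exact (hK.hasDerivAt_conv hΩm hr hgm hgb x).deriv
  have hMu : mulL1 μ (V n) u₀ =ᵐ[μ] g := (mulL1_coeFn _ _).trans ((hV n hn).mul hu₀)
  have hf : convL1 Ω R' (mulL1 μ (V n) u₀) =ᵐ[μ]
      fun x => deriv (fun z => scatteringOp G Ω n z u x) ω := by
    filter_upwards [convL1_coeFn_of_ae_eq hR' hMu, ae_restrict_mem hΩm] with x hx hxΩ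
    rw [hx, conv_indicator_ball_eq hΩm hr le_rfl _ _ (by simpa using hr hxΩ), hder]
  obtain ⟨W, χ, hW0, hW, hχ0, hχf, hχ, hWd⟩ := exists_simple_resonance_branch
    (R := fun z => convL1 Ω (R z)) (R' := convL1 Ω R')
    ((convL1 Ω).hasStrictFDerivAt.comp_hasStrictDerivAt ω hRd) (mulL1 μ) (V n)
    (IsCompactOperator.comp_clm (isCompactOperator_convL1 hΩ hΩm (R ω)) (mulL1 μ (V n)))
    hu₀0 hu₀fix
    (fun v hv => by
      by_cases hv0 : v = 0
      · exact ⟨0, by simp [hv0]⟩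
      obtain ⟨h1, h2⟩ := hpair n hn ω hωρ v hv0 hv
      obtain ⟨c, hc⟩ := hnd.1 _ h1
      refine ⟨c, Lp.ext ?_⟩
      filter_upwards [h2, hu₀, Lp.coeFn_smul c u₀] with x h3 h4 h5
      rw [h5, Pi.smul_apply, h4, ← h3, hc, Pi.smul_apply])
    -- An associated vector `w` in `L¹(Ω)` extends in the same way: `T w + ∂_z T u` agrees with `w`
    -- almost everywhere on `Ω` and solves the associated equation everywhere, against
    -- nondegeneracy.
    (fun w hw => hnd.2 (by
      have h1 : (fun x => scatteringOp G Ω n ω w x + deriv (fun z => scatteringOp G Ω n z u x) ω)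
          =ᵐ[μ] w := by
        filter_upwards [hop n hn ω hωρ w, hf,
          Lp.coeFn_sub w (convL1 Ω (R ω) (mulL1 μ (V n) w))] with x h1 h2 h3
        rw [← h1, ← h2, ← hw, h3, Pi.sub_apply, add_sub_cancel]
      have hd : LocallyIntegrable fun x => deriv (fun z => scatteringOp G Ω n z u x) ω := by
        simp_rw [hder]
        exact locallyIntegrable_conv hΩm hr hK.integrableOn_kernelDeriv hgi
      refine ⟨_, (hloc n hn ω hωρ w).add hd, fun x => ?_⟩
      have h2 := scatteringOp_congr G n ω h1 x
      simp only [Pi.add_apply]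
      rw [sub_eq_iff_eq_add, add_comm, add_right_inj]
      exact h2.symm))
  -- the pairing with `g` and the symmetry of the kernel
  obtain ⟨ψ, hψ⟩ := exists_clm_integral_mul hgm hgb
  -- Evenness of the kernel moves the convolution from `a` onto `g`, and convolving `g` gives back
  -- `u` because `u` is a mode.
  have hsym : ∀ a : Lp ℂ 1 μ, ψ (convL1 Ω (R ω) a) = ∫ y in Ω, u y * a y := by
    intro a
    have h1 : ψ (convL1 Ω (R ω) a) = ∫ x in Ω, g x * ∫ y in Ω,
        (Metric.ball 0 (r + r)).indicator (kernelFun G ω) (x - y) * a y := by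
      rw [hψ]
      refine integral_congr_ae ?_
      filter_upwards [convL1_coeFn_of_ae_eq (hR ω hωρ) (ae_eq_refl (a : E → ℂ))] with x hx
      rw [hx]
    rw [h1, integral_conv_mul_comm
      ((hK.integrableOn_kernelFun hωρ _).integrable_indicator measurableSet_ball) ?_
      (Lp_integrable a) hgm hgb]
    · refine setIntegral_congr_fun hΩm fun y hy => ?_
      rw [conv_indicator_ball_eq hΩm hr le_rfl _ _ (by simpa using hr hy), hgdef,
        ← scatteringOp_eq_conv, ← hu.2.2 y]
    · intro x
      simp only [Set.indicator_apply, mem_ball_zero_iff, norm_neg, kernelFun]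
  have hψ0 : ∀ v, ψ (v - convL1 Ω (R ω) (mulL1 μ (V n) v)) = 0 := by
    intro v
    rw [map_sub, hsym, hψ, sub_eq_zero]
    refine integral_congr_ae ?_
    filter_upwards [mulL1_coeFn (V n) v, hV n hn] with x h1 h2
    rw [h1, h2, hgdef]
    ring
  have hψχ := hχ ψ hψ0
  set F : ℂ := ψ (convL1 Ω R' (mulL1 μ (V n) u₀)) with hFdef
  have hF : F = ∫ x in Ω, (((n x : ℂ) ^ 2 - 1) * u x) *
      deriv (fun z => scatteringOp G Ω n z u x) ω := by
    rw [hFdef, hψ]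
    refine integral_congr_ae ?_
    filter_upwards [hf] with x hx
    rw [hx]
  -- If `F = 0`, then `ψ = F χ` vanishes. Testing it on the conjugate of `g` gives `∫ |g|² = 0`, so
  -- `g = 0` on `Ω`, and the mode, being the convolution of `g`, is zero.
  have hF0 : F ≠ 0 := by
    intro hF0
    have hgc : Integrable (fun x => conj (g x)) μ :=
      ⟨Complex.continuous_conj.comp_aestronglyMeasurable hgm,
        by simpa [HasFiniteIntegral, ← ofReal_norm] using hgi.2⟩
    have h1 := hψχ (hgc.toL1 _)
    rw [hF0, zero_mul, hψ] at h1
    have h2 : ∫ x, g x * (hgc.toL1 _ : Lp ℂ 1 μ) x ∂μ = ((∫ x, ‖g x‖ ^ 2 ∂μ : ℝ) : ℂ) := by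
      rw [← integral_complex_ofReal]
      refine integral_congr_ae ?_
      filter_upwards [hgc.coeFn_toL1] with x hx
      rw [hx, Complex.mul_conj, Complex.normSq_eq_norm_sq]
    rw [h2, Complex.ofReal_eq_zero, integral_eq_zero_iff_of_nonneg (fun x => by positivity)] at h1
    · refine hu.2.1 (funext fun x => ?_)
      rw [hu.2.2 x, scatteringOp_eq_conv, Pi.zero_apply]
      refine integral_eq_zero_of_ae ?_
      filter_upwards [h1] with y hy
      have : g y = 0 := by simpa using hy
      rw [hgdef] at this
      simp only at this
      rw [this, mul_zero, Pi.zero_apply]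
    · have : Integrable (fun x => ‖g x‖ * ‖g x‖) μ :=
        hgi.norm.bdd_mul (c := Cg) hgm.norm (by simpa using hgb)
      simpa only [sq] using this
  -- sup norm estimates
  have hnp0 : 0 < np := hnm.trans hnp
  have hsup : ∀ n' ∈ Admissible Ω nm np, supNorm Ω (n' - n) ≠ ∞ →
      (∀ᵐ x ∂μ, ‖n' x - n x‖ ≤ (supNorm Ω (n' - n)).toReal) ∧
      ‖V n' - V n‖ ≤ 2 * np * (supNorm Ω (n' - n)).toReal := by
    intro n' hn' hfin
    have h1 : ∀ᵐ x ∂μ, ‖n' x - n x‖ ≤ (supNorm Ω (n' - n)).toReal := by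
      have := ae_le_eLpNormEssSup (f := n' - n) (μ := μ)
      filter_upwards [this] with x hx
      rw [← eLpNorm_exponent_top] at hx
      rw [← toReal_enorm]
      exact ENNReal.toReal_mono hfin hx
    refine ⟨h1, ?_⟩
    have h2 : ∀ᵐ x ∂μ, ‖(V n' - V n) x‖ ≤ 2 * np * (supNorm Ω (n' - n)).toReal := by
      filter_upwards [h1, Lp.coeFn_sub (V n') (V n), hV n' hn', hV n hn,
        Admissible.ae_bound hn hnm hΩm, Admissible.ae_bound hn' hnm hΩm] with x h1 h2 h3 h4 h5 h6
      rw [h2, Pi.sub_apply, h3, h4]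
      have : ((n' x : ℂ) ^ 2 - 1) - ((n x : ℂ) ^ 2 - 1) =
          (((n' x + n x) * (n' x - n x) : ℝ) : ℂ) := by push_cast; ring
      rw [this, Complex.norm_real, norm_mul]
      have h7 : ‖n' x + n x‖ ≤ 2 * np := (norm_add_le _ _).trans (by linarith)
      gcongr
    have := Lp.norm_le_of_ae_bound (by positivity) h2
    simpa using this
  -- The factor `ω²` in `α⁻¹ = ω² F` cancels the one in `gradOmega`, so that the first variation is
  -- `-2 F⁻¹ ∫ n u² δn`.
  refine ⟨fun n' => W (V n'), ⟨hW0, ?_⟩, (ω ^ 2 * F)⁻¹, ?_, ?_, ?_, ?_⟩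
  · obtain ⟨ε, hε, hερ, δ, hδ, hδW⟩ := hW ρ hK.pos
    refine ⟨ε, hε, δ / (2 * np), by positivity, fun n' hn' hlt => ?_⟩
    have hfin := hlt.ne_top
    have h1 : ‖V n' - V n‖ < δ := by
      refine (hsup n' hn' hfin).2.trans_lt ?_
      have := (ENNReal.lt_ofReal_iff_toReal_lt hfin).mp hlt
      rw [lt_div_iff₀ (by positivity)] at this
      linarith
    obtain ⟨h2, h3⟩ := hδW (V n') h1
    refine ⟨h2, Set.ext fun z => ?_⟩
    constructor
    · rintro ⟨hz1, hz2⟩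
      exact (h3 z hz2).mp ((hres n' hn' z (Metric.ball_subset_ball hερ hz2)).mp hz1)
    · rintro rfl
      exact ⟨(hres n' hn' _ (Metric.ball_subset_ball hερ h2)).mpr ((h3 _ h2).mpr rfl), h2⟩
  · exact inv_ne_zero (mul_ne_zero (pow_ne_zero 2 hω0) hF0)
  · rw [inv_inv, hF]
  · have hm : AEStronglyMeasurable (gradOmega (ω ^ 2 * F)⁻¹ ω n u) μ := by
      unfold gradOmega
      have h1 : AEStronglyMeasurable (fun x => (n x : ℂ)) μ :=
        (Complex.measurable_ofReal.comp_aemeasurable hn.1.restrict).aestronglyMeasurable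
      have h2 : AEStronglyMeasurable (fun x => conj (u x)) μ :=
        Complex.continuous_conj.comp_aestronglyMeasurable hui.1
      exact (h1.const_mul _).mul (h2.pow 2)
    refine Integrable.of_bound hm
      (‖-2 * conj (ω ^ 2 * F)⁻¹ * conj ω ^ 2‖ * np * B ^ 2) ?_
    filter_upwards [hB, Admissible.ae_bound hn hnm hΩm] with x h1 h2
    rw [gradOmega, norm_mul, norm_mul, norm_pow, RCLike.norm_conj, Complex.norm_real]
    have := norm_nonneg (u x)
    gcongr
  · intro ε hε
    set I := ∫ x, ‖u x‖ ^ 2 ∂μ with hI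
    have hI0 : 0 ≤ I := integral_nonneg fun x => by positivity
    have hmeas : ∀ n' ∈ Admissible Ω nm np, AEStronglyMeasurable (fun x => (n' x : ℂ)) μ :=
      fun n' hn' =>
        (Complex.measurable_ofReal.comp_aemeasurable hn'.1.restrict).aestronglyMeasurable
    have hu2 : Integrable (fun x => u x ^ 2) μ := by
      refine Integrable.of_bound (hui.1.pow 2) (B ^ 2) ?_
      filter_upwards [hB] with x hx
      rw [norm_pow]
      gcongr
    have hlo := hWd.isLittleO
    rw [Asymptotics.isLittleO_iff] at hlo
    obtain ⟨δ₁, hδ₁, hlo⟩ := Metric.eventually_nhds_iff_ball.mp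
      (hlo (show 0 < ε / (4 * np) by positivity))
    -- Two errors, each at most `ε s / 2`: the remainder of `W`, at most `ε / (4 np)` times `‖δV‖ ≤
    -- 2 np s`, and the quadratic term, at most `‖F⁻¹‖ I s²`.
    refine ⟨min (δ₁ / (2 * np)) (ε / (2 * (‖F⁻¹‖ * I + 1))), by positivity, fun n' hn' hlt => ?_⟩
    have hfin := hlt.ne_top
    obtain ⟨hs1, hs2⟩ := hsup n' hn' hfin
    have hs3 := (ENNReal.lt_ofReal_iff_toReal_lt hfin).mp hlt
    have hs0 : 0 ≤ (supNorm Ω (n' - n)).toReal := ENNReal.toReal_nonneg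
    set s := (supNorm Ω (n' - n)).toReal with hs
    have hs4 : 2 * np * s < δ₁ := by
      have := hs3.trans_le (min_le_left _ _)
      rw [lt_div_iff₀ (by positivity)] at this
      linarith
    have hs5 : s * (2 * (‖F⁻¹‖ * I + 1)) < ε := by
      have := hs3.trans_le (min_le_right _ _)
      rwa [lt_div_iff₀ (by positivity)] at this
    have hL := hlo (V n') (by rw [mem_ball_iff_norm]; linarith)
    have hi1 : Integrable (fun x => ((n' x : ℂ) ^ 2 - 1 - ((n x : ℂ) ^ 2 - 1)) * u x ^ 2) μ :=
      hu2.bdd_mul (c := (np ^ 2 + 1) + (np ^ 2 + 1))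
        ((Admissible.aestronglyMeasurable_contrast hn').sub
          (Admissible.aestronglyMeasurable_contrast hn)) (by
        filter_upwards [Admissible.ae_bound_contrast hn' hnm hΩm,
          Admissible.ae_bound_contrast hn hnm hΩm] with x h1 h2
        exact (norm_sub_le _ _).trans (add_le_add h1 h2))
    have hi2 : Integrable (fun x => (n x : ℂ) * ((n' x : ℂ) - n x) * u x ^ 2) μ :=
      hu2.bdd_mul (c := np * s) ((hmeas n hn).mul ((hmeas n' hn').sub (hmeas n hn))) (by
        filter_upwards [hs1, Admissible.ae_bound hn hnm hΩm] with x h1 h2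
        rw [norm_mul, ← Complex.ofReal_sub, Complex.norm_real, Complex.norm_real]
        gcongr)
    have hLV : (-(χ ∘L (convL1 Ω (R ω)) ∘L (mulL1 μ).flip u₀)) (V n' - V n) =
        -(F⁻¹ * ∫ x, ((n' x : ℂ) ^ 2 - 1 - ((n x : ℂ) ^ 2 - 1)) * u x ^ 2 ∂μ) := by
      have h1 : χ (convL1 Ω (R ω) (mulL1 μ (V n' - V n) u₀)) =
          F⁻¹ * ψ (convL1 Ω (R ω) (mulL1 μ (V n' - V n) u₀)) := by
        rw [hψχ, inv_mul_cancel_left₀ hF0]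
      have h2 : ψ (convL1 Ω (R ω) (mulL1 μ (V n' - V n) u₀)) =
          ∫ x, ((n' x : ℂ) ^ 2 - 1 - ((n x : ℂ) ^ 2 - 1)) * u x ^ 2 ∂μ := by
        rw [hsym]
        refine integral_congr_ae ?_
        filter_upwards [mulL1_coeFn (V n' - V n) u₀, Lp.coeFn_sub (V n') (V n), hV n' hn',
          hV n hn, hu₀] with x h1 h2 h3 h4 h5
        rw [h1, h2, Pi.sub_apply, h3, h4, h5]
        ring
      rw [← h2, ← h1]
      rfl
    have hgrad : ∫ x in Ω, conj (gradOmega (ω ^ 2 * F)⁻¹ ω n u x) * ((n' x - n x : ℝ) : ℂ) =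
        -(F⁻¹ * (2 * ∫ x, (n x : ℂ) * ((n' x : ℂ) - n x) * u x ^ 2 ∂μ)) := by
      rw [← integral_const_mul, ← integral_const_mul, ← integral_neg]
      refine integral_congr_ae (Eventually.of_forall fun x => ?_)
      simp only [gradOmega, map_mul, map_neg, map_pow, Complex.conj_conj, Complex.conj_ofReal,
        map_ofNat]
      push_cast
      field_simp
    have hdiff : ‖(-(χ ∘L (convL1 Ω (R ω)) ∘L (mulL1 μ).flip u₀)) (V n' - V n) -
        ∫ x in Ω, conj (gradOmega (ω ^ 2 * F)⁻¹ ω n u x) * ((n' x - n x : ℝ) : ℂ)‖ ≤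
          ‖F⁻¹‖ * (s ^ 2 * I) := by
      -- The contrast is quadratic in the index, and `n'² - n² - 2 n (n' - n) = (n' - n)²` is the
      -- whole second order part.
      have h1 : (∫ x, ((n' x : ℂ) ^ 2 - 1 - ((n x : ℂ) ^ 2 - 1)) * u x ^ 2 ∂μ) -
          2 * ∫ x, (n x : ℂ) * ((n' x : ℂ) - n x) * u x ^ 2 ∂μ =
          ∫ x, ((n' x : ℂ) - n x) ^ 2 * u x ^ 2 ∂μ := by
        rw [← integral_const_mul, ← integral_sub hi1 (hi2.const_mul 2)]
        congr 1; ext x; ring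
      rw [hLV, hgrad, neg_sub_neg, ← mul_sub, norm_mul, norm_sub_rev, h1]
      refine mul_le_mul_of_nonneg_left ?_ (norm_nonneg _)
      rw [hI, ← integral_const_mul]
      refine norm_integral_le_of_norm_le ((by simpa [norm_pow] using hu2.norm :
        Integrable (fun x => ‖u x‖ ^ 2) μ).const_mul _) ?_
      filter_upwards [hs1] with x hx
      rw [norm_mul, norm_pow, norm_pow, ← Complex.ofReal_sub, Complex.norm_real]
      gcongr
    calc ‖W (V n') - W (V n) -
          ∫ x in Ω, conj (gradOmega (ω ^ 2 * F)⁻¹ ω n u x) * ((n' x - n x : ℝ) : ℂ)‖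
        ≤ ‖W (V n') - W (V n) -
            (-(χ ∘L (convL1 Ω (R ω)) ∘L (mulL1 μ).flip u₀)) (V n' - V n)‖ +
          ‖(-(χ ∘L (convL1 Ω (R ω)) ∘L (mulL1 μ).flip u₀)) (V n' - V n) -
            ∫ x in Ω, conj (gradOmega (ω ^ 2 * F)⁻¹ ω n u x) * ((n' x - n x : ℝ) : ℂ)‖ :=
          norm_sub_le_norm_sub_add_norm_sub _ _ _
      _ ≤ ε / (4 * np) * (2 * np * s) + ‖F⁻¹‖ * (s ^ 2 * I) := by
          refine add_le_add (hL.trans ?_) hdiff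
          gcongr
      _ = ε / 2 * s + ‖F⁻¹‖ * I * s * s := by
          field_simp; ring
      _ ≤ ε * s := by nlinarith [norm_nonneg F⁻¹]

end Generic

end ScatteringResonance

namespace ScatteringResonance

/-! ### The outgoing Green's functions are holomorphic kernels -/

section Green

/-- On a disc of radius `A` the terms are dominated by those of the exponential series of `(A /
2)²`, so the Weierstrass theorem applies. Both Bessel series have such coefficients, the one for
`Y₀` because harmonic numbers satisfy `Hₖ ≤ k ≤ k!`. -/
theorem differentiable_tsum_mul_pow {a : ℕ → ℂ} (ha : ∀ k, ‖a k‖ ≤ 1 / (k ! : ℝ)) :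
    Differentiable ℂ fun z : ℂ => ∑' k : ℕ, a k * (z / 2) ^ (2 * k) := by
  intro z₀
  have hmem : z₀ ∈ Metric.ball (0 : ℂ) (‖z₀‖ + 1) := by simp
  refine (Complex.differentiableOn_tsum_of_summable_norm
    (u := fun k : ℕ => (((‖z₀‖ + 1) / 2) ^ 2) ^ k / (k ! : ℝ))
    (Real.summable_pow_div_factorial _) (fun k => by fun_prop) Metric.isOpen_ball
    (fun k z hz => ?_)).differentiableAt (Metric.isOpen_ball.mem_nhds hmem)
  rw [mem_ball_zero_iff] at hz
  rw [norm_mul, norm_pow, norm_div, Complex.norm_ofNat, pow_mul, div_eq_mul_one_div _ (k ! : ℝ),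
    mul_comm]
  have h1 := ha k
  gcongr

theorem differentiable_besselJ0 : Differentiable ℂ besselJ0 := by
  refine differentiable_tsum_mul_pow (a := fun k => (-1 : ℂ) ^ k / ((k ! : ℂ)) ^ 2) fun k => ?_
  have h1 : (1 : ℝ) ≤ (k ! : ℝ) := by exact_mod_cast Nat.one_le_iff_ne_zero.mpr k.factorial_ne_zero
  rw [norm_div, norm_pow, norm_neg, norm_one, one_pow, norm_pow, Complex.norm_natCast]
  gcongr
  nlinarith

theorem harmonic_le_self (k : ℕ) : harmonic k ≤ k := by
  rw [harmonic]
  refine (Finset.sum_le_card_nsmul _ _ 1 fun i _ => ?_).trans (by simp)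
  exact inv_le_one_of_one_le₀ (by push_cast; linarith [i.cast_nonneg (α := ℚ)])

theorem differentiable_besselY0_series : Differentiable ℂ fun z : ℂ =>
    ∑' k : ℕ, (-1 : ℂ) ^ (k + 1) * ((harmonic k : ℚ) : ℂ) / ((k ! : ℂ)) ^ 2 *
        (z / 2) ^ (2 * k) := by
  refine differentiable_tsum_mul_pow
    (a := fun k => (-1 : ℂ) ^ (k + 1) * ((harmonic k : ℚ) : ℂ) / ((k ! : ℂ)) ^ 2) fun k => ?_
  have h1 : (0 : ℝ) < (k ! : ℝ) := by exact_mod_cast k.factorial_pos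
  have h2 : ‖((harmonic k : ℚ) : ℂ)‖ ≤ (k ! : ℝ) := by
    have h3 : ((harmonic k : ℚ) : ℂ) = (((harmonic k : ℚ) : ℝ) : ℂ) := by push_cast; rfl
    have h4 : (0 : ℚ) ≤ harmonic k := Finset.sum_nonneg fun i _ => by positivity
    rw [h3, Complex.norm_real, Real.norm_of_nonneg (by exact_mod_cast h4)]
    calc ((harmonic k : ℚ) : ℝ) ≤ ((k : ℚ) : ℝ) := by exact_mod_cast harmonic_le_self k
      _ = (k : ℝ) := by simp
      _ ≤ (k ! : ℝ) := by exact_mod_cast k.self_le_factorial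
  rw [norm_div, norm_mul, norm_pow, norm_neg, norm_one, one_pow, one_mul, norm_pow,
    Complex.norm_natCast, div_le_div_iff₀ (by positivity) h1]
  nlinarith

variable {E : Type*} [NormedAddCommGroup E] [NormedSpace ℝ E] [FiniteDimensional ℝ E]
  [MeasureSpace E] [BorelSpace E] [(volume : Measure E).IsAddHaarMeasure] [Nontrivial E]

/-- Polar coordinates: the weight `r ^ (d - 1)` absorbs the singularity at the origin, leaving the
continuous function `h`. For `d = 3` this handles `1 / r`, for `d = 2` it handles `log r`. -/
theorem integrableOn_ball_norm {f h : ℝ → ℝ} (hh : Continuous h)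
    (hfh : ∀ r, 0 < r → r ^ (Module.finrank ℝ E - 1) * f r = h r) (D : ℝ) :
    IntegrableOn (fun x : E => f ‖x‖) (Metric.ball 0 D) := by
  rw [integrableOn_fun_norm_addHaar volume]
  have h2 : IntegrableOn h (Set.Ioo 0 D) :=
    (hh.integrableOn_Icc (a := 0) (b := D)).mono_set Set.Ioo_subset_Icc_self
  exact h2.congr_fun (fun r hr => (hfh r hr.1).symm) measurableSet_Ioo

theorem norm_exp_I_mul_le {z : ℂ} {r A D : ℝ} (hr : 0 < r) (hrD : r < D) (hz : ‖z‖ ≤ A) :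
    ‖Complex.exp (Complex.I * z * r)‖ ≤ Real.exp (A * D) := by
  rw [Complex.norm_exp]
  refine Real.exp_le_exp.mpr ((Complex.re_le_norm _).trans ?_)
  rw [norm_mul, norm_mul, Complex.norm_I, one_mul, Complex.norm_real, Real.norm_of_nonneg hr.le]
  have := norm_nonneg z
  have hA := this.trans hz
  gcongr

theorem norm_le_of_mem_ball {z ω : ℂ} {ρ : ℝ} (hz : z ∈ Metric.ball ω ρ) : ‖z‖ ≤ ‖ω‖ + ρ := by
  rw [mem_ball_iff_norm] at hz
  have := norm_le_insert' z ω
  linarith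

/-- The factor `z²` cancels the pole at `z = 0`, where the convention `0⁻¹ = 0` is also consistent,
so the one-dimensional kernel is entire in the frequency. -/
theorem sq_mul_green1 (r : ℝ) (z : ℂ) :
    z ^ 2 * green1 r z = -(2 * Complex.I)⁻¹ * z * Complex.exp (Complex.I * z * r) := by
  rw [green1]
  by_cases hz : z = 0
  · simp [hz]
  · field_simp

omit [BorelSpace E] [Nontrivial E] in
theorem isHolomorphicKernel_green1 (ω : ℂ) : IsHolomorphicKernel E green1 ω 1 where
  pos := one_pos
  measurable z := by unfold green1; fun_prop
  differentiableOn r _ := by simp_rw [sq_mul_green1]; fun_prop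
  bound D := by
    refine ⟨fun _ => ‖(2 * Complex.I)⁻¹‖ * (‖ω‖ + 1) * Real.exp ((‖ω‖ + 1) * D),
      integrableOn_const Metric.isBounded_ball.measure_lt_top.ne, fun r hr hrD z hz => ?_⟩
    rw [sq_mul_green1, norm_mul, norm_mul, norm_neg]
    have h1 := norm_le_of_mem_ball hz
    have h2 := norm_exp_I_mul_le hr hrD h1
    beta_reduce
    gcongr

theorem isHolomorphicKernel_green3 (hE : Module.finrank ℝ E = 3) (ω : ℂ) :
    IsHolomorphicKernel E green3 ω 1 where
  pos := one_pos
  measurable z := by unfold green3; fun_prop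
  differentiableOn r _ := by unfold green3; fun_prop
  bound D := by
    refine ⟨fun r => (‖ω‖ + 1) ^ 2 * ((4 * Real.pi)⁻¹ * Real.exp ((‖ω‖ + 1) * D)) * r⁻¹,
      integrableOn_ball_norm
        (f := fun r => (‖ω‖ + 1) ^ 2 * ((4 * Real.pi)⁻¹ * Real.exp ((‖ω‖ + 1) * D)) * r⁻¹)
        (h := fun r => (‖ω‖ + 1) ^ 2 * ((4 * Real.pi)⁻¹ * Real.exp ((‖ω‖ + 1) * D)) * r)
        (by fun_prop) (fun r hr => by rw [hE, show 3 - 1 = 2 from rfl]; field_simp) D, fun r hr hrD z hz => ?_⟩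
    have h1 := norm_le_of_mem_ball hz
    have h2 := norm_exp_I_mul_le hr hrD h1
    have h3 : ‖(4 * (Real.pi : ℂ) * (r : ℂ))⁻¹‖ = (4 * Real.pi)⁻¹ * r⁻¹ := by
      rw [norm_inv, norm_mul, norm_mul, Complex.norm_real, Complex.norm_real,
        Real.norm_of_nonneg hr.le, Real.norm_of_nonneg Real.pi_pos.le, Complex.norm_ofNat, mul_inv]
    rw [green3, norm_mul, norm_mul, norm_pow, h3]
    have hpi := Real.pi_pos
    calc ‖z‖ ^ 2 * ((4 * Real.pi)⁻¹ * r⁻¹ * ‖Complex.exp (Complex.I * z * r)‖)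
        ≤ (‖ω‖ + 1) ^ 2 * ((4 * Real.pi)⁻¹ * r⁻¹ * Real.exp ((‖ω‖ + 1) * D)) := by gcongr
      _ = _ := by ring

theorem exists_isHolomorphicKernel_green2 (hE : Module.finrank ℝ E = 2) {lg : ℂ → ℂ} {ω : ℂ}
    (hlg : IsLogDeterminationAt lg ω) : ∃ ρ, IsHolomorphicKernel E (green2 lg) ω ρ := by
  obtain ⟨ρ, hρ, hball⟩ := Metric.eventually_nhds_iff_ball.mp
    (hlg.1.eventually_analyticAt.and
      (hlg.1.continuousAt.norm.eventually_lt_const (lt_add_one ‖lg ω‖)))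
  have hJ := differentiable_besselJ0
  have hS := differentiable_besselY0_series
  set S : ℂ → ℂ := fun z => ∑' k : ℕ, (-1 : ℂ) ^ (k + 1) * ((harmonic k : ℚ) : ℂ) /
    ((k ! : ℂ)) ^ 2 * (z / 2) ^ (2 * k) with hSdef
  have hG : ∀ r z, green2 lg r z = -(4 * Complex.I)⁻¹ * (besselJ0 (z * r) + Complex.I *
      (2 / (Real.pi : ℂ) * ((lg z + (Real.log r : ℂ) - (Real.log 2 : ℂ) +
        (Real.eulerMascheroniConstant : ℂ)) * besselJ0 (z * r) + S (z * r)))) := fun r z => rfl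
  refine ⟨ρ, hρ, fun z => ?_, fun r hr => ?_, fun D => ?_⟩
  · simp_rw [hG]
    have h1 : Measurable fun r : ℝ => besselJ0 (z * r) :=
      (hJ.continuous.comp (by fun_prop)).measurable
    have h2 : Measurable fun r : ℝ => S (z * r) := (hS.continuous.comp (by fun_prop)).measurable
    have h3 : Measurable fun r : ℝ => ((Real.log r : ℝ) : ℂ) := by fun_prop
    fun_prop
  · simp_rw [hG]
    have h1 : DifferentiableOn ℂ lg (Metric.ball ω ρ) := fun z hz =>
      (hball z hz).1.differentiableAt.differentiableWithinAt
    have h2 : Differentiable ℂ fun z : ℂ => besselJ0 (z * r) := hJ.comp (by fun_prop)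
    have h3 : Differentiable ℂ fun z : ℂ => S (z * r) := hS.comp (by fun_prop)
    have h2' := h2.differentiableOn (s := Metric.ball ω ρ)
    have h3' := h3.differentiableOn (s := Metric.ball ω ρ)
    fun_prop
  -- For `r < D` the argument `z r` stays in a fixed compact disc, so both entire series are bounded
  -- and only `log r` can blow up; the weight `r` turns it into the continuous function `r log r`.
  · set A := ‖ω‖ + ρ
    have hc : IsCompact (Metric.closedBall (0 : ℂ) (A * D)) := isCompact_closedBall _ _
    obtain ⟨M₁, hM₁⟩ := hc.exists_bound_of_continuousOn hJ.continuous.continuousOn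
    obtain ⟨M₂, hM₂⟩ := hc.exists_bound_of_continuousOn hS.continuous.continuousOn
    set c := ‖lg ω‖ + 1 + ‖(Real.log 2 : ℂ)‖ + ‖(Real.eulerMascheroniConstant : ℂ)‖ with hcdef
    set b : ℝ → ℝ := fun r => A ^ 2 * (‖(4 * Complex.I)⁻¹‖ * (M₁ + ‖(2 / (Real.pi : ℂ))‖ *
      ((c + |Real.log r|) * M₁ + M₂))) with hb
    refine ⟨b, integrableOn_ball_norm (h := fun r => A ^ 2 * (‖(4 * Complex.I)⁻¹‖ *
      (r * M₁ + ‖(2 / (Real.pi : ℂ))‖ * ((r * c + |r * Real.log r|) * M₁ + r * M₂)))) ?_ ?_ D, ?_⟩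
    · have := Real.continuous_mul_log
      fun_prop
    · intro r hr
      rw [hE, hb, abs_mul, abs_of_pos hr]
      ring
    · intro r hr hrD z hz
      have hzA := norm_le_of_mem_ball hz
      have hmem : z * r ∈ Metric.closedBall (0 : ℂ) (A * D) := by
        rw [mem_closedBall_zero_iff, norm_mul, Complex.norm_real, Real.norm_of_nonneg hr.le]
        have := norm_nonneg z
        gcongr
      have h1 := hM₁ _ hmem
      have h2 := hM₂ _ hmem
      have h3 : ‖lg z + (Real.log r : ℂ) - (Real.log 2 : ℂ) +
          (Real.eulerMascheroniConstant : ℂ)‖ ≤ c + |Real.log r| := by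
        have e1 := norm_add_le (lg z + (Real.log r : ℂ) - (Real.log 2 : ℂ))
          (Real.eulerMascheroniConstant : ℂ)
        have e2 := norm_sub_le (lg z + (Real.log r : ℂ)) (Real.log 2 : ℂ)
        have e3 := norm_add_le (lg z) (Real.log r : ℂ)
        have e4 := (hball z hz).2
        rw [Complex.norm_real (Real.log r), Real.norm_eq_abs] at e3
        linarith
      have hM₁0 : 0 ≤ M₁ := (norm_nonneg _).trans h1
      rw [hG, hb, norm_mul, norm_pow, norm_mul, norm_neg]
      beta_reduce
      gcongr
      refine (norm_add_le _ _).trans ?_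
      rw [norm_mul, norm_mul, Complex.norm_I, one_mul]
      gcongr
      refine (norm_add_le _ _).trans ?_
      rw [norm_mul]
      gcongr

end Green

end ScatteringResonance

namespace ScatteringResonance

/-! ### Indefinite integrals on the line -/

section Primitive

/-- `F` is an indefinite integral of the locally integrable function `ψ`. -/
structure IsPrimitiveOf {E : Type*} [NormedAddCommGroup E] [NormedSpace ℝ E] (F ψ : ℝ → E) :
    Prop where
  integrable : ∀ a b, IntervalIntegrable ψ volume a b
  eq_add_integral : ∀ x, F x = F 0 + ∫ t in (0 : ℝ)..x, ψ t

namespace IsPrimitiveOf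

variable {E E' : Type*} [NormedAddCommGroup E] [NormedSpace ℝ E] [NormedAddCommGroup E']
  [NormedSpace ℝ E'] {F G ψ η : ℝ → E}

theorem of_integrable (hψ : ∀ a b, IntervalIntegrable ψ volume a b) (c : E) :
    IsPrimitiveOf (fun x => c + ∫ t in (0 : ℝ)..x, ψ t) ψ :=
  ⟨hψ, fun x => by simp⟩

theorem continuous [CompleteSpace E] (h : IsPrimitiveOf F ψ) : Continuous F := by
  rw [funext h.eq_add_integral]
  exact continuous_const.add (intervalIntegral.continuous_primitive h.integrable 0)

theorem congr (h : IsPrimitiveOf F ψ) (hF : ∀ x, G x = F x) (hψ : ∀ x, η x = ψ x) :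
    IsPrimitiveOf G η := by
  rwa [funext hF, funext hψ]

theorem add (hF : IsPrimitiveOf F ψ) (hG : IsPrimitiveOf G η) :
    IsPrimitiveOf (fun x => F x + G x) (fun x => ψ x + η x) :=
  ⟨fun a b => (hF.integrable a b).add (hG.integrable a b), fun x => by
    rw [intervalIntegral.integral_add (hF.integrable _ _) (hG.integrable _ _),
      hF.eq_add_integral x, hG.eq_add_integral x]
    abel⟩

theorem clm_comp [CompleteSpace E] [CompleteSpace E'] (hF : IsPrimitiveOf F ψ) (A : E →L[ℝ] E') :
    IsPrimitiveOf (fun x => A (F x)) (fun x => A (ψ x)) :=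
  ⟨fun a b => ⟨A.integrable_comp (hF.integrable a b).1, A.integrable_comp (hF.integrable a b).2⟩,
    fun x => by
    rw [A.intervalIntegral_comp_comm (hF.integrable _ _), ← map_add, ← hF.eq_add_integral x]⟩

theorem sub_eq_integral (hF : IsPrimitiveOf F ψ) (x : ℝ) :
    F x - F 0 = ∫ t in (0 : ℝ)..x, ψ t := by
  rw [hF.eq_add_integral x, add_sub_cancel_left]

theorem of_hasDerivAt [CompleteSpace E] (h : ∀ x, HasDerivAt F (ψ x) x) (hψ : Continuous ψ) :
    IsPrimitiveOf F ψ :=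
  ⟨fun a b => hψ.intervalIntegrable a b, fun x => by
    rw [intervalIntegral.integral_eq_sub_of_hasDerivAt (fun y _ => h y)
      (hψ.intervalIntegrable _ _)]
    abel⟩

theorem hasDerivAt [CompleteSpace E] (h : IsPrimitiveOf F ψ) (hψ : Continuous ψ) (x : ℝ) :
    HasDerivAt F (ψ x) x := by
  rw [funext h.eq_add_integral]
  exact (intervalIntegral.integral_hasDerivAt_right (h.integrable 0 x)
    (hψ.stronglyMeasurableAtFilter _ _) hψ.continuousAt).const_add _

/-- The index is merely measurable, so second derivatives of modes exist only almost everywhere.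
Primitives are absolutely continuous, and this is integration by parts for such functions. -/
theorem mul_real {F G ψ η : ℝ → ℝ} (hF : IsPrimitiveOf F ψ) (hG : IsPrimitiveOf G η) :
    IsPrimitiveOf (fun x => F x * G x) (fun x => ψ x * G x + F x * η x) := by
  refine ⟨fun a b => ((hF.integrable a b).mul_continuousOn hG.continuous.continuousOn).add
    ((hG.integrable a b).continuousOn_mul hF.continuous.continuousOn), fun x => ?_⟩
  have hac : ∀ {F ψ : ℝ → ℝ}, IsPrimitiveOf F ψ → AbsolutelyContinuousOnInterval F 0 x ∧
      ∀ᵐ t, t ∈ Set.uIoc 0 x → deriv F t = ψ t := by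
    intro F ψ hF
    constructor
    · rw [funext hF.eq_add_integral]
      refine AbsolutelyContinuousOnInterval.add ?_
        ((hF.integrable 0 x).absolutelyContinuousOnInterval_intervalIntegral (by simp))
      exact (LipschitzOnWith.absolutelyContinuousOnInterval
        ((LipschitzWith.const (F 0)).lipschitzOnWith (s := Set.uIcc 0 x)))
    · filter_upwards [(hF.integrable 0 x).ae_hasDerivAt_integral] with t ht htx
      have := (ht (Set.uIoc_subset_uIcc htx) 0 (by simp)).const_add (F 0)
      rw [← funext hF.eq_add_integral] at this
      exact this.deriv
  have h := (hac hF).1.integral_deriv_mul_eq_sub (hac hG).1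
  rw [intervalIntegral.integral_congr_ae (g := fun t => ψ t * G t + F t * η t)] at h
  · rw [h]; ring
  · filter_upwards [(hac hF).2, (hac hG).2] with t h1 h2 ht
    rw [h1 ht, h2 ht]

theorem mul {F G ψ η : ℝ → ℂ} (hF : IsPrimitiveOf F ψ) (hG : IsPrimitiveOf G η) :
    IsPrimitiveOf (fun x => F x * G x) (fun x => ψ x * G x + F x * η x) := by
  have hFr := hF.clm_comp Complex.reCLM
  have hFi := hF.clm_comp Complex.imCLM
  have hGr := hG.clm_comp Complex.reCLM
  have hGi := hG.clm_comp Complex.imCLM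
  have h1 := (hFr.mul_real hGr).add ((hFi.mul_real hGi).clm_comp (-(1 : ℝ →L[ℝ] ℝ)))
  have h2 := (hFr.mul_real hGi).add (hFi.mul_real hGr)
  refine ((h1.clm_comp Complex.ofRealCLM).add
    ((h2.clm_comp Complex.ofRealCLM).clm_comp
      (ContinuousLinearMap.mul ℝ ℂ Complex.I))).congr (fun x => ?_) (fun x => ?_)
  · apply Complex.ext <;> simp; ring
  · apply Complex.ext <;> simp <;> ring

end IsPrimitiveOf

end Primitive

end ScatteringResonance

namespace ScatteringResonance

/-! ### The resonance problem on an interval -/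

section Interval

variable {L : ℝ} {g : ℝ → ℂ} {ω : ℂ}

theorem integral_Iic_eq_intervalIntegral {h : ℝ → ℂ} (hh : Integrable h)
    (h0 : ∀ t < 0, h t = 0) (x : ℝ) : ∫ t in Set.Iic x, h t = ∫ t in (0 : ℝ)..x, h t := by
  have hz : ∫ t in Set.Iic (0 : ℝ), h t = 0 := by
    rw [integral_Iic_eq_integral_Iio]
    exact setIntegral_eq_zero_of_forall_eq_zero fun t ht => h0 t ht
  rw [← intervalIntegral.integral_Iic_sub_Iic hh.integrableOn hh.integrableOn, hz, sub_zero]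

theorem integrable_mul_indicator_Icc (hg : IntegrableOn g (Set.Icc 0 L)) {w : ℝ → ℂ}
    (hw : Continuous w) : Integrable fun t => w t * (Set.Icc 0 L).indicator g t := by
  have := (hg.continuousOn_mul hw.continuousOn isCompact_Icc).integrable_indicator
    measurableSet_Icc
  refine this.congr (Eventually.of_forall fun t => ?_)
  by_cases ht : t ∈ Set.Icc 0 L <;> simp [ht]

/-- A kernel in `|x - y|` has one formula for `y ≤ x` and another for `y > x`. Writing the second
integral as the full one minus its part up to `x` makes both pieces primitives in `x`. -/
theorem integral_Icc_split (hg : IntegrableOn g (Set.Icc 0 L)) {k k₁ k₂ : ℝ → ℂ}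
    (h₁ : Continuous k₁) (h₂ : Continuous k₂) {x : ℝ} (hk₁ : ∀ y ≤ x, k y = k₁ y)
    (hk₂ : ∀ y, x < y → k y = k₂ y) :
    ∫ y in Set.Icc 0 L, k y * g y =
      (∫ y in (0 : ℝ)..x, k₁ y * (Set.Icc 0 L).indicator g y) +
        ((∫ y, k₂ y * (Set.Icc 0 L).indicator g y) -
          ∫ y in (0 : ℝ)..x, k₂ y * (Set.Icc 0 L).indicator g y) := by
  have i₁ := integrable_mul_indicator_Icc hg h₁
  have i₂ := integrable_mul_indicator_Icc hg h₂
  have hz : ∀ w : ℝ → ℂ, ∀ t < 0, w t * (Set.Icc 0 L).indicator g t = 0 := fun w t ht => by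
    rw [Set.indicator_of_notMem (fun h => absurd h.1 (not_le.2 ht)), mul_zero]
  rw [← integral_Iic_eq_intervalIntegral i₁ (hz _), ← integral_Iic_eq_intervalIntegral i₂ (hz _),
    ← intervalIntegral.integral_Iic_add_Ioi (b := x) i₂.integrableOn i₂.integrableOn,
    add_sub_cancel_left, ← integral_indicator measurableSet_Icc]
  have e₁ : ∀ y ∈ Set.Iic x, k₁ y * (Set.Icc 0 L).indicator g y =
      (Set.Icc 0 L).indicator (fun y => k y * g y) y := fun y hy => by
    by_cases ht : y ∈ Set.Icc 0 L <;> simp [ht, hk₁ y hy]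
  have e₂ : ∀ y ∈ Set.Ioi x, k₂ y * (Set.Icc 0 L).indicator g y =
      (Set.Icc 0 L).indicator (fun y => k y * g y) y := fun y hy => by
    by_cases ht : y ∈ Set.Icc 0 L <;> simp [ht, hk₂ y hy]
  rw [setIntegral_congr_fun measurableSet_Iic e₁, setIntegral_congr_fun measurableSet_Ioi e₂]
  exact (intervalIntegral.integral_Iic_add_Ioi
    (i₁.integrableOn.congr_fun e₁ measurableSet_Iic)
    (i₂.integrableOn.congr_fun e₂ measurableSet_Ioi)).symm

theorem integral_mul_indicator_Icc (hL : 0 < L) (w : ℝ → ℂ) :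
    ∫ y, w y * (Set.Icc 0 L).indicator g y =
      ∫ y in (0 : ℝ)..L, w y * (Set.Icc 0 L).indicator g y := by
  rw [intervalIntegral.integral_of_le hL.le, ← integral_Icc_eq_integral_Ioc,
    setIntegral_eq_integral_of_forall_compl_eq_zero]
  intro x hx
  rw [Set.indicator_of_notMem hx, mul_zero]

theorem isPrimitiveOf_integral_mul_indicator (hg : IntegrableOn g (Set.Icc 0 L)) {w : ℝ → ℂ}
    (hw : Continuous w) : IsPrimitiveOf
      (fun x => ∫ t in (0 : ℝ)..x, w t * (Set.Icc 0 L).indicator g t)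
      (fun t => w t * (Set.Icc 0 L).indicator g t) :=
  (IsPrimitiveOf.of_integrable
    (fun _ _ => (integrable_mul_indicator_Icc hg hw).intervalIntegrable) 0).congr
    (fun _ => (zero_add _).symm) fun _ => rfl

theorem isPrimitiveOf_sub_integral_mul_indicator (hg : IntegrableOn g (Set.Icc 0 L)) {w : ℝ → ℂ}
    (hw : Continuous w) (c : ℂ) : IsPrimitiveOf
      (fun x => c - ∫ t in (0 : ℝ)..x, w t * (Set.Icc 0 L).indicator g t)
      (fun t => -(w t * (Set.Icc 0 L).indicator g t)) :=
  (IsPrimitiveOf.of_integrable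
    (fun _ _ => (integrable_mul_indicator_Icc hg hw).neg.intervalIntegrable) c).congr
    (fun _ => by simp [sub_eq_add_neg]) fun _ => rfl

/-- The outgoing solution on the line, and its derivative in the frequency, satisfy the Helmholtz
equation with outgoing boundary conditions, and the equation derived from it. -/
theorem exists_helmholtz_primitives (hL : 0 < L) (hg : IntegrableOn g (Set.Icc 0 L)) {u f : ℝ → ℂ}
    (hu : ∀ x, u x = ∫ y in Set.Icc 0 L,
      -(2 * Complex.I)⁻¹ * ω * Complex.exp (Complex.I * ω * (‖x - y‖ : ℝ)) * g y)
    (hf : ∀ x, f x = ∫ y in Set.Icc 0 L,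
      -(2 * Complex.I)⁻¹ * (1 + Complex.I * ω * (‖x - y‖ : ℝ)) *
        Complex.exp (Complex.I * ω * (‖x - y‖ : ℝ)) * g y) :
    ∃ p q : ℝ → ℂ, IsPrimitiveOf u p ∧
      IsPrimitiveOf p (fun x => -ω ^ 2 * (u x + (Set.Icc 0 L).indicator g x)) ∧
      IsPrimitiveOf f q ∧
      IsPrimitiveOf q
        (fun x => -ω ^ 2 * f x - 2 * ω * (u x + (Set.Icc 0 L).indicator g x)) ∧
      p L = Complex.I * ω * u L ∧ p 0 = -(Complex.I * ω * u 0) ∧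
      q L = Complex.I * ω * f L + Complex.I * u L ∧
      q 0 = -(Complex.I * ω * f 0 + Complex.I * u 0) := by
  have hc : -(2 * Complex.I)⁻¹ = Complex.I / 2 := by
    rw [mul_inv, Complex.inv_I]; ring
  rw [hc] at hu hf
  set h := (Set.Icc 0 L).indicator g with hh
  set ep : ℝ → ℂ := fun t => Complex.exp (Complex.I * ω * t) with hep
  set em : ℝ → ℂ := fun t => Complex.exp (-(Complex.I * ω * t)) with hem
  have hEM : ∀ t, ep t * em t = 1 := fun t => by
    simp only [hep, hem]; rw [← Complex.exp_add, add_neg_cancel, Complex.exp_zero]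
  have cep : Continuous ep := by fun_prop
  have cem : Continuous em := by fun_prop
  have cof : Continuous fun t : ℝ => (t : ℂ) := Complex.continuous_ofReal
  have pof : IsPrimitiveOf (fun t : ℝ => (t : ℂ)) (fun _ => 1) :=
    .of_hasDerivAt (fun x => Complex.ofRealCLM.hasDerivAt) continuous_const
  have pep : IsPrimitiveOf ep (fun t => Complex.I * ω * ep t) := by
    refine .of_hasDerivAt (fun x => ?_) (by fun_prop)
    have := ((Complex.ofRealCLM.hasDerivAt (x := x)).const_mul (Complex.I * ω)).cexp
    simp only [Complex.ofRealCLM_apply, Complex.ofReal_one, mul_one] at this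
    exact this.congr_deriv (mul_comm _ _)
  have pem : IsPrimitiveOf em (fun t => -(Complex.I * ω) * em t) := by
    refine .of_hasDerivAt (fun x => ?_) (by fun_prop)
    have := ((Complex.ofRealCLM.hasDerivAt (x := x)).const_mul (Complex.I * ω)).neg.cexp
    simp only [Complex.ofRealCLM_apply, Complex.ofReal_one, mul_one] at this
    exact this.congr_deriv (mul_comm _ _)
  have pc : ∀ c : ℂ, IsPrimitiveOf (fun _ : ℝ => c) (fun _ => 0) := fun c =>
    .of_hasDerivAt (fun x => hasDerivAt_const x c) continuous_const
  have pA : IsPrimitiveOf (fun x => ∫ t in (0 : ℝ)..x, em t * (Set.Icc 0 L).indicator g t)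
      (fun t => em t * (Set.Icc 0 L).indicator g t) := isPrimitiveOf_integral_mul_indicator hg cem
  have pA₁ : IsPrimitiveOf (fun x => ∫ t in (0 : ℝ)..x, t * em t * (Set.Icc 0 L).indicator g t)
      (fun t => t * em t * (Set.Icc 0 L).indicator g t) := isPrimitiveOf_integral_mul_indicator hg (cof.mul cem)
  have pB := isPrimitiveOf_sub_integral_mul_indicator hg cep (∫ t, ep t * h t)
  have pB₁ : IsPrimitiveOf (fun x => (∫ t, t * ep t * h t) -
      ∫ t in (0 : ℝ)..x, t * ep t * (Set.Icc 0 L).indicator g t)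
      (fun t => -(t * ep t * (Set.Icc 0 L).indicator g t)) := isPrimitiveOf_sub_integral_mul_indicator hg (cof.mul cep) (∫ t, (t * ep t) * h t)
  rw [← hh] at pA pA₁ pB pB₁
  have BL := integral_mul_indicator_Icc (g := g) hL ep
  have B₁L := integral_mul_indicator_Icc (g := g) hL fun t => t * ep t
  rw [← hh] at BL B₁L
  set A : ℝ → ℂ := fun x => ∫ t in (0 : ℝ)..x, em t * h t with hA
  set A₁ : ℝ → ℂ := fun x => ∫ t in (0 : ℝ)..x, t * em t * h t with hA₁
  set B : ℝ → ℂ := fun x => (∫ t, ep t * h t) - ∫ t in (0 : ℝ)..x, ep t * h t with hB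
  set B₁ : ℝ → ℂ := fun x => (∫ t, t * ep t * h t) - ∫ t in (0 : ℝ)..x, t * ep t * h t with hB₁
  have A0 : A 0 = 0 := intervalIntegral.integral_same
  have A₁0 : A₁ 0 = 0 := intervalIntegral.integral_same
  replace BL : B L = 0 := sub_eq_zero.2 BL
  replace B₁L : B₁ L = 0 := sub_eq_zero.2 B₁L
  have ep0 : ep 0 = 1 := by simp [hep]
  have em0 : em 0 = 1 := by simp [hem]
  -- Both kernels, for `u` and for its frequency derivative, are on each side of `x` an affine
  -- function of `y` times an exponential, so four primitives express everything. Those based at `0`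
  -- vanish there, and the complementary ones vanish at `L`.
  have key : ∀ x (a b a' b' : ℂ) (k : ℝ → ℂ),
      (∀ y ≤ x, k y = (a + b * y) * em y) → (∀ y, x < y → k y = (a' + b' * y) * ep y) →
      ∫ y in Set.Icc 0 L, k y * g y = a * A x + b * A₁ x + (a' * B x + b' * B₁ x) := by
    intro x a b a' b' k h1 h2
    rw [integral_Icc_split hg (k₁ := fun y => (a + b * y) * em y)
      (k₂ := fun y => (a' + b' * y) * ep y) (by fun_prop) (by fun_prop) h1 h2, ← hh]
    have s1 : ∀ (a b : ℂ) (e : ℝ → ℂ) (t : ℝ), (a + b * t) * e t * h t =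
        a * (e t * h t) + b * (t * e t * h t) := fun a b e t => by ring
    simp_rw [s1]
    have i1 : Integrable fun t => em t * h t := integrable_mul_indicator_Icc hg cem
    have i2 : Integrable fun t => t * em t * h t := integrable_mul_indicator_Icc hg (cof.mul cem)
    have i3 : Integrable fun t => ep t * h t := integrable_mul_indicator_Icc hg cep
    have i4 : Integrable fun t => t * ep t * h t := integrable_mul_indicator_Icc hg (cof.mul cep)
    rw [intervalIntegral.integral_add (i1.const_mul a).intervalIntegrable
        (i2.const_mul b).intervalIntegrable,
      intervalIntegral.integral_add (i3.const_mul a').intervalIntegrable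
        (i4.const_mul b').intervalIntegrable,
      integral_add (i3.const_mul a') (i4.const_mul b')]
    simp only [intervalIntegral.integral_const_mul, integral_const_mul, hA, hA₁, hB, hB₁]
    ring
  have n1 : ∀ {x y : ℝ}, y ≤ x → Complex.exp (Complex.I * ω * (‖x - y‖ : ℝ)) = ep x * em y := by
    intro x y hxy
    rw [Real.norm_of_nonneg (sub_nonneg.2 hxy), ← Complex.exp_add]
    congr 1; push_cast; ring
  have n2 : ∀ {x y : ℝ}, x < y → Complex.exp (Complex.I * ω * (‖x - y‖ : ℝ)) = em x * ep y := by
    intro x y hxy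
    rw [Real.norm_of_nonpos (sub_nonpos.2 hxy.le), ← Complex.exp_add]
    congr 1; push_cast; ring
  have hu' : ∀ x, u x = Complex.I / 2 * ω * ep x * A x + 0 * A₁ x +
      (Complex.I / 2 * ω * em x * B x + 0 * B₁ x) := by
    intro x
    rw [hu x]
    refine key x _ _ _ _ _ (fun y hy => ?_) (fun y hy => ?_)
    · rw [n1 hy]; ring
    · rw [n2 hy]; ring
  have hf' : ∀ x : ℝ, f x = Complex.I / 2 * (1 + Complex.I * ω * x) * ep x * A x +
        -(Complex.I / 2 * (Complex.I * ω) * ep x) * A₁ x +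
      (Complex.I / 2 * (1 - Complex.I * ω * x) * em x * B x +
        Complex.I / 2 * (Complex.I * ω) * em x * B₁ x) := by
    intro x
    rw [hf x]
    refine key x _ _ _ _ _ (fun y hy => ?_) (fun y hy => ?_)
    · rw [n1 hy, Real.norm_of_nonneg (sub_nonneg.2 hy)]; push_cast; ring
    · rw [n2 hy, Real.norm_of_nonpos (sub_nonpos.2 hy.le)]; push_cast; ring
  have I2 : Complex.I ^ 2 = -1 := Complex.I_sq
  clear_value A A₁ B B₁ ep em h
  -- These are the formal derivatives of `hu'` and `hf'`. The terms in `h` from differentiating the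
  -- primitives cancel because `ep * em = 1`; at the next derivative they add up and give the source
  -- terms.
  refine ⟨fun x => Complex.I / 2 * ω * (Complex.I * ω) * (ep x * A x + (-1) * (em x * B x)),
    fun x => Complex.I / 2 * ((Complex.I * ω) * ((2 + Complex.I * ω * x) * (ep x * A x)
      + (-2 + Complex.I * ω * x) * (em x * B x)) + ω ^ 2 * (ep x * A₁ x + em x * B₁ x)),
    ?_, ?_, ?_, ?_, ?_, ?_, ?_, ?_⟩
  · refine ((pc (Complex.I / 2 * ω)).mul ((pep.mul pA).add (pem.mul pB))).congr
      (fun x => ?_) (fun x => ?_)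
    · rw [hu' x]; ring
    · ring
  · refine ((pc (Complex.I / 2 * ω * (Complex.I * ω))).mul
      ((pep.mul pA).add ((pc (-1)).mul (pem.mul pB)))).congr (fun x => rfl) (fun x => ?_)
    rw [hu' x]
    linear_combination (-(ω ^ 3 * Complex.I / 2 * (ep x * A x + em x * B x)) -
      ω ^ 2 * h x * (ep x * em x)) * I2 + ω ^ 2 * h x * hEM x
  · refine ((pc (Complex.I / 2)).mul
      (((((pc 1).add ((pc (Complex.I * ω)).mul pof)).mul (pep.mul pA)).add
        (((pc 1).add ((pc (-(Complex.I * ω))).mul pof)).mul (pem.mul pB))).add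
        ((pc (Complex.I * ω)).mul ((pem.mul pB₁).add ((pc (-1)).mul (pep.mul pA₁)))))).congr
      (fun x => ?_) (fun x => ?_)
    · rw [hf' x]; ring
    · linear_combination (Complex.I * ω ^ 2 / 2 * (ep x * A₁ x + em x * B₁ x)) * I2
  · refine ((pc (Complex.I / 2)).mul
      (((pc (Complex.I * ω)).mul
        ((((pc 2).add ((pc (Complex.I * ω)).mul pof)).mul (pep.mul pA)).add
        (((pc (-2)).add ((pc (Complex.I * ω)).mul pof)).mul (pem.mul pB)))).add
        ((pc (ω ^ 2)).mul ((pep.mul pA₁).add (pem.mul pB₁))))).congr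
      (fun x => ?_) (fun x => ?_)
    · ring
    · rw [hf' x, hu' x]
      linear_combination (-(ω ^ 2 * Complex.I / 2 * ((3 + Complex.I * ω * x) * (ep x * A x) +
        (3 - Complex.I * ω * x) * (em x * B x))) - 2 * ω * h x * (ep x * em x)) * I2 +
        2 * ω * h x * hEM x
  · beta_reduce; rw [hu' L, BL, B₁L]; ring
  · beta_reduce; rw [hu' 0, A0, A₁0]; ring
  · beta_reduce; rw [hu' L, hf' L, BL, B₁L]; linear_combination (Complex.I * ω ^ 2 / 2 * ep L * A₁ L) * I2
  · beta_reduce; rw [hu' 0, hf' 0, A0, A₁0, ep0, em0, Complex.ofReal_zero]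
    linear_combination (Complex.I * ω ^ 2 / 2 * B₁ 0) * I2

end Interval

end ScatteringResonance

namespace ScatteringResonance

/-! ### The normalizing constant on an interval, by Green's identity. -/

section Interval

variable {L nm np : ℝ} {ω : ℂ} {n : ℝ → ℝ} {u : ℝ → ℂ}

/-- The two expressions for the normalizing constant on an interval, by integration by parts. -/
theorem normalization_eq_of_primitives (hL : 0 < L) (hω : ω ≠ 0) {f p q : ℝ → ℂ} {m : ℝ → ℂ}
    (hg : IntegrableOn (fun x => (m x - 1) * u x) (Set.Icc 0 L))
    (hu : IsPrimitiveOf u p)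
    (hp : IsPrimitiveOf p
      (fun x => -ω ^ 2 * (u x + (Set.Icc 0 L).indicator (fun x => (m x - 1) * u x) x)))
    (hf : IsPrimitiveOf f q)
    (hq : IsPrimitiveOf q (fun x => -ω ^ 2 * f x -
      2 * ω * (u x + (Set.Icc 0 L).indicator (fun x => (m x - 1) * u x) x)))
    (hpL : p L = Complex.I * ω * u L) (hp0 : p 0 = -(Complex.I * ω * u 0))
    (hqL : q L = Complex.I * ω * f L + Complex.I * u L)
    (hq0 : q 0 = -(Complex.I * ω * f 0 + Complex.I * u 0)) :
    ω ^ 2 * (∫ x in Set.Icc 0 L, ((m x - 1) * u x) * f x) =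
        2 * ω * (∫ x in (0 : ℝ)..L, m x * u x ^ 2) + Complex.I * (u 0 ^ 2 + u L ^ 2) ∧
      2 * ω * (∫ x in (0 : ℝ)..L, m x * u x ^ 2) + Complex.I * (u 0 ^ 2 + u L ^ 2) =
        ω⁻¹ * ∫ x in (0 : ℝ)..L, (p x ^ 2 + ω ^ 2 * m x * u x ^ 2) := by
  have hgi : IntervalIntegrable (fun x => (m x - 1) * u x) volume 0 L :=
    (intervalIntegrable_iff_integrableOn_Icc_of_le hL.le).2 hg
  have ind : ∀ x ∈ Set.uIcc 0 L, (Set.Icc 0 L).indicator (fun x => (m x - 1) * u x) x =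
      (m x - 1) * u x := fun x hx => by
    rw [Set.uIcc_of_le hL.le] at hx
    exact Set.indicator_of_mem hx _
  have i1 : IntervalIntegrable (fun x => ((m x - 1) * u x) * f x) volume 0 L :=
    hgi.mul_continuousOn hf.continuous.continuousOn
  have i2 : IntervalIntegrable (fun x => m x * u x ^ 2) volume 0 L := by
    refine ((hgi.mul_continuousOn hu.continuous.continuousOn).add
      ((hu.continuous.pow 2).intervalIntegrable 0 L)).congr fun x _ => ?_
    change (m x - 1) * u x * u x + u x ^ 2 = m x * u x ^ 2
    ring
  have i3 : IntervalIntegrable (fun x => p x ^ 2) volume 0 L :=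
    (hp.continuous.pow 2).intervalIntegrable 0 L
  have h1 := (hp.mul hf).sub_eq_integral L
  have h2 := (hu.mul hq).sub_eq_integral L
  have h3 := (hu.mul hp).sub_eq_integral L
  -- The integrand is the derivative of `p f - u q`: the products `p q` and `u f` cancel. The
  -- outgoing conditions reduce the boundary terms to `-i (u(0)² + u(L)²)`.
  have h12 : (∫ t in (0 : ℝ)..L, (-ω ^ 2 * (((m t - 1) * u t) * f t) + 2 * ω * (m t * u t ^ 2))) =
      (p L * f L - p 0 * f 0) - (u L * q L - u 0 * q 0) := by
    rw [h1, h2, ← intervalIntegral.integral_sub ((hp.mul hf).integrable 0 L)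
      ((hu.mul hq).integrable 0 L)]
    refine intervalIntegral.integral_congr fun x hx => ?_
    rw [ind x hx]; ring
  -- The integrand is the derivative of `u p`, and the outgoing conditions turn the boundary terms
  -- into `i ω (u(0)² + u(L)²)`.
  have h33 : (∫ t in (0 : ℝ)..L, (p t ^ 2 + -ω ^ 2 * (m t * u t ^ 2))) =
      u L * p L - u 0 * p 0 := by
    rw [h3]
    refine intervalIntegral.integral_congr fun x hx => ?_
    rw [ind x hx]; ring
  rw [intervalIntegral.integral_add (i1.const_mul _) (i2.const_mul _),
    intervalIntegral.integral_const_mul, intervalIntegral.integral_const_mul, hpL, hp0, hqL, hq0]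
    at h12
  rw [intervalIntegral.integral_add i3 (i2.const_mul _), intervalIntegral.integral_const_mul,
    hpL, hp0] at h33
  simp_rw [mul_assoc (ω ^ 2)]
  rw [intervalIntegral.integral_add i3 (i2.const_mul _), intervalIntegral.integral_const_mul,
    integral_Icc_eq_integral_Ioc, ← intervalIntegral.integral_of_le hL.le]
  constructor
  · linear_combination -h12
  · rw [eq_inv_mul_iff_mul_eq₀ hω]
    linear_combination -h33

theorem kernelDeriv_green1 (ω : ℂ) (x : ℝ) : kernelDeriv green1 ω x =
    -(2 * Complex.I)⁻¹ * (1 + Complex.I * ω * (‖x‖ : ℝ)) *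
      Complex.exp (Complex.I * ω * (‖x‖ : ℝ)) := by
  rw [kernelDeriv]
  simp_rw [sq_mul_green1]
  have h := ((hasDerivAt_id ω).const_mul (-(2 * Complex.I)⁻¹)).mul
    (((hasDerivAt_id ω).const_mul Complex.I).mul_const ((‖x‖ : ℝ) : ℂ)).cexp
  refine h.deriv.trans ?_
  simp only [id]
  ring

/-- A mode on an interval is `C¹`, and the normalizing constant of its resonance has two explicit
expressions. -/
theorem IsResonancePair.contDiff_and_normalization_eq (hL : 0 < L) (hnm : 0 < nm)
    (hn : n ∈ Admissible (Set.Icc 0 L) nm np)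
    (hu : IsResonancePair green1 (Set.Icc 0 L) n ω u) (hω : ω ≠ 0) :
    ContDiff ℝ 1 u ∧
    ω ^ 2 * (∫ x in Set.Icc 0 L, (((n x : ℂ) ^ 2 - 1) * u x) *
      deriv (fun z => scatteringOp green1 (Set.Icc 0 L) n z u x) ω) =
        2 * ω * (∫ x in (0 : ℝ)..L, (n x : ℂ) ^ 2 * u x ^ 2) + Complex.I * (u 0 ^ 2 + u L ^ 2) ∧
      2 * ω * (∫ x in (0 : ℝ)..L, (n x : ℂ) ^ 2 * u x ^ 2) + Complex.I * (u 0 ^ 2 + u L ^ 2) =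
        ω⁻¹ * ∫ x in (0 : ℝ)..L, (deriv u x ^ 2 + ω ^ 2 * (n x : ℂ) ^ 2 * u x ^ 2) := by
  have hK : IsHolomorphicKernel ℝ green1 ω 1 := isHolomorphicKernel_green1 ω
  have hb : Bornology.IsBounded (Set.Icc (0 : ℝ) L) := Metric.isBounded_Icc 0 L
  obtain ⟨B, hB⟩ := hu.exists_ae_bound hK hnm measurableSet_Icc hb hn
  obtain ⟨r, hr⟩ := hb.subset_ball 0
  have hgm : AEStronglyMeasurable (fun x => ((n x : ℂ) ^ 2 - 1) * u x)
      (volume.restrict (Set.Icc 0 L)) :=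
    (Admissible.aestronglyMeasurable_contrast hn).mul hu.1.aestronglyMeasurable.restrict
  have hgb : ∀ᵐ x ∂volume.restrict (Set.Icc 0 L),
      ‖((n x : ℂ) ^ 2 - 1) * u x‖ ≤ (np ^ 2 + 1) * B := by
    filter_upwards [hB, Admissible.ae_bound_contrast hn hnm measurableSet_Icc] with x h1 h2
    rw [norm_mul]
    exact mul_le_mul h2 h1 (norm_nonneg _) (by positivity)
  have hg : IntegrableOn (fun x => ((n x : ℂ) ^ 2 - 1) * u x) (Set.Icc 0 L) :=
    Integrable.of_bound hgm _ hgb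
  obtain ⟨p, q, h1, h2, h3, h4, h5, h6, h7, h8⟩ := exists_helmholtz_primitives (ω := ω) (u := u)
    (f := fun x => deriv (fun z => scatteringOp green1 (Set.Icc 0 L) n z u x) ω) hL hg
    (fun x => by
      rw [hu.2.2 x, scatteringOp_eq_conv]
      simp only [kernelFun, sq_mul_green1])
    (fun x => by
      simp_rw [scatteringOp_eq_conv]
      rw [(hK.hasDerivAt_conv measurableSet_Icc hr hgm hgb x).deriv]
      simp only [kernelDeriv_green1])
  -- The density `p` is itself a primitive, hence continuous, so `u` is `C¹` however rough the index
  -- is.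
  have hd : deriv u = p := funext fun x => (h1.hasDerivAt h2.continuous x).deriv
  refine ⟨contDiff_one_iff_deriv.2 ⟨fun x => (h1.hasDerivAt h2.continuous x).differentiableAt,
    hd ▸ h2.continuous⟩, ?_⟩
  rw [hd]
  exact normalization_eq_of_primitives hL hω hg h1 h2 h3 h4 h5 h6 h7 h8

end Interval

end ScatteringResonance

theorem proposition4p1 (nm np : ℝ) (hnm : 0 < nm) (hnp : nm < np) :
    -- dimensions one, two and three
    (∀ (d : ℕ), d = 1 ∨ d = 2 ∨ d = 3 →
      ∀ (Ω : Set (EuclideanSpace ℝ (Fin d))), IsOpen Ω → Bornology.IsBounded Ω →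
      ∀ (lg : ℂ → ℂ) (n : EuclideanSpace ℝ (Fin d) → ℝ) (ω : ℂ)
        (u : EuclideanSpace ℝ (Fin d) → ℂ),
        ScatteringResonance.IsLogDeterminationAt lg ω →
        n ∈ ScatteringResonance.Admissible Ω nm np →
        ScatteringResonance.IsResonancePair (ScatteringResonance.outgoingGreen lg d) Ω n ω u →
        ScatteringResonance.IsNondegenerate (ScatteringResonance.outgoingGreen lg d) Ω n ω u →
        ∃ W : (EuclideanSpace ℝ (Fin d) → ℝ) → ℂ,
          ScatteringResonance.IsResonanceMapAt (ScatteringResonance.outgoingGreen lg d)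
            Ω nm np n ω W ∧
          ∃ α : ℂ, α ≠ 0 ∧
            ScatteringResonance.HasFirstVariationAt Ω nm np W n
              (ScatteringResonance.gradOmega α ω n u)) ∧
    -- dimension one, with the interval `[0, L]`
    (∀ (L : ℝ), 0 < L → ∀ (n : ℝ → ℝ) (ω : ℂ) (u : ℝ → ℂ),
        n ∈ ScatteringResonance.Admissible (Set.Icc 0 L) nm np →
        ScatteringResonance.IsResonancePair ScatteringResonance.green1 (Set.Icc 0 L) n ω u →
        ScatteringResonance.IsNondegenerate ScatteringResonance.green1 (Set.Icc 0 L) n ω u →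
        ContDiff ℝ 1 u ∧
        ∃ W : (ℝ → ℝ) → ℂ,
          ScatteringResonance.IsResonanceMapAt ScatteringResonance.green1
            (Set.Icc 0 L) nm np n ω W ∧
          ∃ α : ℂ, α ≠ 0 ∧
            α⁻¹ = 2 * ω * (∫ x in (0 : ℝ)..L, (n x : ℂ) ^ 2 * u x ^ 2)
              + Complex.I * (u 0 ^ 2 + u L ^ 2) ∧
            α⁻¹ = ω⁻¹ * ∫ x in (0 : ℝ)..L, (deriv u x ^ 2 + ω ^ 2 * (n x : ℂ) ^ 2 * u x ^ 2) ∧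
            ScatteringResonance.HasFirstVariationAt (Set.Icc 0 L) nm np W n
              (ScatteringResonance.gradOmega α ω n u)) := by
  open ScatteringResonance in
  constructor
  · intro d hd Ω hΩo hΩ lg n ω u hlg hn hu hnd
    have hrank : Module.finrank ℝ (EuclideanSpace ℝ (Fin d)) = d := finrank_euclideanSpace_fin
    have : Nontrivial (EuclideanSpace ℝ (Fin d)) :=
      Module.nontrivial_of_finrank_pos (R := ℝ) (by omega)
    obtain ⟨ρ, hK⟩ : ∃ ρ, IsHolomorphicKernel (EuclideanSpace ℝ (Fin d))
        (outgoingGreen lg d) ω ρ := by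
      rcases hd with rfl | rfl | rfl
      · exact ⟨1, isHolomorphicKernel_green1 ω⟩
      · exact exists_isHolomorphicKernel_green2 hrank hlg
      · exact ⟨1, isHolomorphicKernel_green3 hrank ω⟩
    obtain ⟨W, hW, α, hα, -, hV⟩ := exists_resonanceMap hK hnm hnp hΩo.measurableSet hΩ hn hu hnd
    exact ⟨W, hW, α, hα, hV⟩
  · intro L hL n ω u hn hu hnd
    have hω : ω ≠ 0 := hu.omega_ne_zero
    obtain ⟨W, hW, α, hα, hα', hV⟩ := exists_resonanceMap (isHolomorphicKernel_green1 ω) hnm hnp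
      measurableSet_Icc (Metric.isBounded_Icc 0 L) hn hu hnd
    obtain ⟨h1, h2, h3⟩ := hu.contDiff_and_normalization_eq hL hnm hn hω
    exact ⟨h1, W, hW, α, hα, hα'.trans h2, hα'.trans (h2.trans h3), hV⟩
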